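/- Let $(\Omega,d)$ be a connected metric space and $\mu$ a Borel probability measure on $\Omega$. Write $\mathrm{Lip}(\Omega)$ for the Lipschitz functions $f:\Omega\to\mathbb R$, $|\nabla f|(x)=\limsup_{y\to x,\,y\ne x}\frac{|f(x)-f(y)|}{d(x,y)}$ (read as $0$ at an isolated point), and, for Borel $A$, $\mu^+(A)=\liminf_{h\to0^+}\frac{\mu(A_h)-\mu(A)}{h}$ with $A_h=\{x:d(x,A)<h\}$. Assume that for every $f\in\mathrm{Lip}(\Omega)$ and $c\in\mathbb R$ one has $|\nabla f|=0$ $\mu$-a.e. on $\{f=c\}$. Put $\mu_f(s)=\mu\{f>s\}$ and $f^\bigstar(t)=\inf\{s\in\mathbb R:\mu_f(s)\le t\}$ for $0<t<1$. For a measurable function $u$ on a probability space with measure $\nu$, let $u^*(s)=\inf\{t\ge0:\nu\{|u|>t\}\le s\}$. Call $m$ a median of $f$ if $\mu\{f\ge m\}\ge\frac12$ and $\mu\{f\le m\}\ge\frac12$, and put $\mathrm{Osc}_\mu(f)=\operatorname{ess\,sup}f-\operatorname{ess\,inf}f$. Let $I:[0,1]\to[0,\infty)$ be continuous, convex on $[0,\frac12]$,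 increasing on $(0,\frac12)$, symmetric about $\frac12$, with $I(0)=0$ and $I>0$ on $(0,1)$. Put $\beta_1(s)=\sup_{s<t\le 1/2}\frac{t-s}{I(t)}$, with $\sup\emptyset=0$. Then the following are equivalent: 1. (Isoperimetric inequality) $\mu^+(A)\ge I(\mu(A))$ for all Borel $A\subset\Omega$. 2. (Ledoux's inequality) $\int_{-\infty}^{\infty}I(\mu_f(s))\,ds\le\int_\Omega|\nabla f|\,d\mu$ for all $f\in\mathrm{Lip}(\Omega)$. 3. For every $f\in\mathrm{Lip}(\Omega)$, $f^\bigstar$ is locally absolutely continuous on $(0,1)$ and, for all $0<t\le1$, $$\int_0^t\big((-f^\bigstar)'I\big)^*(s)\,ds\le\int_0^t|\nabla f|^*(s)\,ds,$$ where the rearrangement on the left is with respect to Lebesgue measure on $(0,1)$ and the one on the right with respect to $\mu$. 4. (Bobkov's inequality) For every bounded $f\in\mathrm{Lip}(\Omega)$ having $0$ as a median, and every $s>0$, $$\int_\Omega|f|\,d\mu\le\beta_1(s)\int_\Omega|\nabla f|\,d\mu+s\,\mathrm{Osc}_\mu(f).$$ -/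

import Mathlib

open MeasureTheory Set Filter Topology
open scoped ENNReal

/-- The structural conditions on a convex isoperimetric estimator `I : [0,1] → [0,∞)` (only the
values of `I` on `[0,1]` matter). Convexity is required on the half interval `[0,1/2]` and carried to
`[1/2,1]` by the symmetry: no positive function vanishing at `0` and `1` is convex on `[0,1]`.
No relation between `I` and a measure is imposed here. -/
structure IsConvexEstimator (I : ℝ → ℝ) : Prop where
  nonneg : ∀ t ∈ Icc (0 : ℝ) 1, 0 ≤ I t
  continuousOn : ContinuousOn I (Icc 0 1)
  convexOn : ConvexOn ℝ (Icc 0 (1 / 2)) I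
  monotoneOn : MonotoneOn I (Ioo 0 (1 / 2))
  symm : ∀ t ∈ Icc (0 : ℝ) 1, I (1 - t) = I t
  zero : I 0 = 0
  pos : ∀ t ∈ Ioo (0 : ℝ) 1, 0 < I t

/-- `f ∈ Lip(Ω)`: `f` is (globally) Lipschitz. -/
def IsLip {Ω : Type*} [MetricSpace Ω] (f : Ω → ℝ) : Prop :=
  ∃ K : NNReal, LipschitzWith K f

/-- The modulus of the gradient `|∇f|(x) = limsup_{y → x, y ≠ x} |f x - f y| / d(x,y)`.
It is `0` at an isolated point. -/
noncomputable def gradNorm {Ω : Type*} [MetricSpace Ω] (f : Ω → ℝ) (x : Ω) : ℝ≥0∞ :=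
  limsup (fun y => edist (f x) (f y) / edist x y) (𝓝[≠] x)

/-- The Minkowski content `μ⁺(A) = liminf_{h → 0+} (μ(A_h) - μ(A)) / h`, where `A_h` is the open
`h`-neighbourhood of `A`. -/
noncomputable def minkowskiContent {Ω : Type*} [MetricSpace Ω] [MeasurableSpace Ω]
    (μ : Measure Ω) (A : Set Ω) : ℝ≥0∞ :=
  liminf (fun h : ℝ => (μ (Metric.thickening h A) - μ A) / ENNReal.ofReal h) (𝓝[>] 0)

/-- For every Lipschitz `f` and every real `c`, `|∇f| = 0` almost everywhere on `{f = c}`. -/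
def GradVanishesOnLevels {Ω : Type*} [MetricSpace Ω] [MeasurableSpace Ω]
    (μ : Measure Ω) : Prop :=
  ∀ f : Ω → ℝ, IsLip f → ∀ c : ℝ, ∀ᵐ x ∂μ, f x = c → gradNorm f x = 0

/-- The distribution function `μ_f(s) = μ {f > s}`. -/
noncomputable def distribFn {Ω : Type*} [MeasurableSpace Ω] (μ : Measure Ω) (f : Ω → ℝ)
    (s : ℝ) : ℝ :=
  μ.real {x | s < f x}

/-- The signed decreasing rearrangement `f^★(t) = inf {s ∈ ℝ : μ_f(s) ≤ t}`, for `0 < t < 1`. -/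
noncomputable def signedRearr {Ω : Type*} [MeasurableSpace Ω] (μ : Measure Ω) (f : Ω → ℝ)
    (t : ℝ) : ℝ :=
  sInf {s : ℝ | distribFn μ f s ≤ t}

/-- The decreasing rearrangement `u^*(s) = inf {t ≥ 0 : μ {u > t} ≤ s}` of a function
`u ≥ 0`; for a real-valued function `g` it is applied to `|g|`. -/
noncomputable def decRearr {α : Type*} [MeasurableSpace α] (μ : Measure α) (u : α → ℝ≥0∞)
    (s : ℝ) : ℝ≥0∞ :=
  sInf {t : ℝ≥0∞ | μ {x | t < u x} ≤ ENNReal.ofReal s}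

/-- `g` is locally absolutely continuous on the open interval `(0,1)`. -/
def LocallyAbsContOnUnit (g : ℝ → ℝ) : Prop :=
  ∀ a b : ℝ, 0 < a → a < b → b < 1 → AbsolutelyContinuousOnInterval g a b

/-- `m` is a median of `f`. -/
def IsMedianOf {Ω : Type*} [MeasurableSpace Ω] (μ : Measure Ω) (f : Ω → ℝ) (m : ℝ) : Prop :=
  1 / 2 ≤ μ {x | m ≤ f x} ∧ 1 / 2 ≤ μ {x | f x ≤ m}

/-- `β₁(s) = sup_{s < t ≤ 1/2} (t - s) / I(t)`. The supremum of the empty family, which occurs for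
`s ≥ 1/2`, is `0`; for `0 < s < 1/2` the family is bounded when `I` is a convex estimator. -/
noncomputable def betaOne (I : ℝ → ℝ) (s : ℝ) : ℝ :=
  sSup ((fun t => (t - s) / I t) '' Ioc s (1 / 2))

/-- `Osc_μ(f) = ess sup f - ess inf f`, for bounded `f`. -/
noncomputable def oscOf {Ω : Type*} [MeasurableSpace Ω] (μ : Measure Ω) (f : Ω → ℝ) : ℝ :=
  essSup f μ - essInf f μ

/-- The isoperimetric inequality. -/
def IsoperimetricIneq {Ω : Type*} [MetricSpace Ω] [MeasurableSpace Ω]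
    (μ : Measure Ω) (I : ℝ → ℝ) : Prop :=
  ∀ A : Set Ω, MeasurableSet A → ENNReal.ofReal (I (μ.real A)) ≤ minkowskiContent μ A

/-- Ledoux's inequality. -/
def LedouxIneq {Ω : Type*} [MetricSpace Ω] [MeasurableSpace Ω]
    (μ : Measure Ω) (I : ℝ → ℝ) : Prop :=
  ∀ f : Ω → ℝ, IsLip f →
    ∫⁻ s : ℝ, ENNReal.ofReal (I (distribFn μ f s)) ≤ ∫⁻ x, gradNorm f x ∂μ

/-- The symmetrization inequality; the rearrangement on the left is with respect to Lebesgue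
measure on `(0,1)`. -/
def SymmetrizationIneq {Ω : Type*} [MetricSpace Ω] [MeasurableSpace Ω]
    (μ : Measure Ω) (I : ℝ → ℝ) : Prop :=
  ∀ f : Ω → ℝ, IsLip f →
    LocallyAbsContOnUnit (signedRearr μ f) ∧
    ∀ t ∈ Ioc (0 : ℝ) 1,
      ∫⁻ s in Ioo 0 t, decRearr (volume.restrict (Ioo (0 : ℝ) 1))
          (fun r => ‖deriv (fun q => -signedRearr μ f q) r * I r‖ₑ) s
        ≤ ∫⁻ s in Ioo 0 t, decRearr μ (gradNorm f) s

/-- Bobkov's inequality. -/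
def BobkovIneq {Ω : Type*} [MetricSpace Ω] [MeasurableSpace Ω]
    (μ : Measure Ω) (I : ℝ → ℝ) : Prop :=
  ∀ f : Ω → ℝ, IsLip f → (∃ C : ℝ, ∀ x, |f x| ≤ C) → IsMedianOf μ f 0 →
    ∀ s : ℝ, 0 < s →
      ∫⁻ x, ‖f x‖ₑ ∂μ ≤
        ENNReal.ofReal (betaOne I s) * ∫⁻ x, gradNorm f x ∂μ + ENNReal.ofReal (s * oscOf μ f)

/-! The implications run 1 → 2, 2 ↔ 3, 2 → 4 and 4 → 1.

1 → 2 is a coarea inequality. By Fubini, the mass gained when all superlevel sets of `f` are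
thickened by `h`, integrated over the level, is at most `h` times the integral of the largest slope
at scale `h` (`lintegral_measure_thickening_diff_le`). Divide by `h`: Fatou on the level side and
dominated convergence on the slope side give the limit.

2 → 3: truncating `f` localizes Ledoux's inequality to an interval of levels, and a Vitali covering
argument extends it to Borel sets (`LedouxIneq.setLIntegral_le`). After discarding the atoms of the
law of `f`, a set `E ⊆ (0,1)` is matched by a set of mass at most `|E|` carrying enough gradient.
For null `E` this gives the absolute continuity of `f^★`; for general `E` it is the input of the
Hardy-Littlewood-Pólya comparison `setLIntegral_decRearr_mono`. Conversely, 3 at `t = 1` is 2 after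
the change of variables `s = f^★(r)`.

2 → 4 integrates `t ≤ β₁(s) I(t) + s` along the two tails of `f`, each at most `1/2` because `0` is
a median. 4 → 1 tests Bobkov's inequality on a tent function around `A` and then recovers `I` from
`β₁` by supporting lines (`IsConvexEstimator.le_of_forall_betaOne`). -/

/-! ### Slopes at a fixed scale, measurability of the gradient, and the Fubini estimate. -/

section Slope

variable {Ω : Type*} [MetricSpace Ω]

/-- The largest difference quotient of `f` between `x` and another point of the ball `B(x, r)`. -/
noncomputable def slopeSup (f : Ω → ℝ) (r : ℝ) (x : Ω) : ℝ≥0∞ :=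
  ⨆ y ∈ {x}ᶜ ∩ Metric.ball x r, edist (f x) (f y) / edist x y

theorem slopeSup_mono (f : Ω → ℝ) (x : Ω) : Monotone fun r => slopeSup f r x := fun _ _ h =>
  biSup_mono fun _ hy => ⟨hy.1, Metric.ball_subset_ball h hy.2⟩

theorem gradNorm_eq_iInf (f : Ω → ℝ) (x : Ω) :
    gradNorm f x = ⨅ n : ℕ, slopeSup f (1 / ((n : ℝ) + 1)) x := by
  have h := nhdsWithin_hasBasis (Metric.nhds_basis_ball_inv_nat_succ (x := x)) ({x}ᶜ)
  rw [gradNorm, h.limsup_eq_iInf_iSup]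
  simp [slopeSup, inter_comm]

/-- For fixed `y` the quotient is continuous in `x` on the open punctured ball around `y`; extended
by `0` it is lower semicontinuous, and so is the supremum over `y`. This is what makes an
uncountable supremum measurable. -/
theorem lowerSemicontinuous_slopeSup {f : Ω → ℝ} (hf : Continuous f) (r : ℝ) :
    LowerSemicontinuous (slopeSup f r) := by
  have h : slopeSup f r = fun x => ⨆ y : Ω, indicator ({y}ᶜ ∩ Metric.ball y r)
      (fun x => edist (f x) (f y) / edist x y) x := by
    funext x
    unfold slopeSup
    congr 1
    funext y
    by_cases hy : y ∈ {x}ᶜ ∩ Metric.ball x r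
    · have hx : x ∈ {y}ᶜ ∩ Metric.ball y r :=
        ⟨fun h => hy.1 (by simp_all), Metric.mem_ball_comm.1 hy.2⟩
      rw [indicator_of_mem hx]
      simp [hy]
    · have hx : x ∉ {y}ᶜ ∩ Metric.ball y r := fun hx =>
        hy ⟨fun h => hx.1 (by simp_all), Metric.mem_ball_comm.1 hx.2⟩
      rw [indicator_of_notMem hx]
      simp [hy]
  rw [h]
  refine lowerSemicontinuous_iSup fun y x => ?_
  have hopen : IsOpen ({y}ᶜ ∩ Metric.ball y r) := isOpen_compl_singleton.inter Metric.isOpen_ball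
  by_cases hx : x ∈ {y}ᶜ ∩ Metric.ball y r
  · have hne : edist x y ≠ 0 := by simpa using hx.1
    have hc : ContinuousAt (fun x => edist (f x) (f y) / edist x y) x := by
      refine ENNReal.Tendsto.div (hf.edist continuous_const).continuousAt (Or.inr hne)
        (continuous_id.edist continuous_const).continuousAt (Or.inl ?_)
      exact edist_ne_top _ _
    have hc' : ContinuousAt (indicator ({y}ᶜ ∩ Metric.ball y r)
        (fun x => edist (f x) (f y) / edist x y)) x :=
      hc.congr (Filter.eventually_of_mem (hopen.mem_nhds hx) fun z hz =>
        (indicator_of_mem hz (fun x => edist (f x) (f y) / edist x y)).symm)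
    exact hc'.lowerSemicontinuousAt
  · intro c hc
    rw [indicator_of_notMem hx] at hc
    exact absurd hc not_lt_zero

theorem slopeSup_le {f : Ω → ℝ} {K : NNReal} (hf : LipschitzWith K f) (r : ℝ) (x : Ω) :
    slopeSup f r x ≤ K :=
  iSup₂_le fun y _ => ENNReal.div_le_of_le_mul (hf x y)

theorem gradNorm_le {f : Ω → ℝ} {K : NNReal} (hf : LipschitzWith K f) (x : Ω) :
    gradNorm f x ≤ K := by
  rw [gradNorm_eq_iInf]
  exact (iInf_le _ 0).trans (slopeSup_le hf _ x)

theorem gradNorm_mono {f g : Ω → ℝ} (h : ∀ x y, edist (f x) (f y) ≤ edist (g x) (g y)) (x : Ω) :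
    gradNorm f x ≤ gradNorm g x :=
  limsup_le_limsup (Eventually.of_forall fun y => ENNReal.div_le_div_right (h x y) _)

theorem tendsto_slopeSup (f : Ω → ℝ) (x : Ω) :
    Tendsto (fun n : ℕ => slopeSup f (1 / ((n : ℝ) + 1)) x) atTop (𝓝 (gradNorm f x)) := by
  rw [gradNorm_eq_iInf]
  exact tendsto_atTop_iInf fun m n h => slopeSup_mono f x (Nat.one_div_le_one_div h)

theorem lintegral_gradNorm_ne_top [MeasurableSpace Ω] {f : Ω → ℝ} (hf : IsLip f) (μ : Measure Ω)
    [IsFiniteMeasure μ] : ∫⁻ x, gradNorm f x ∂μ ≠ ∞ := by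
  obtain ⟨K, hK⟩ := hf
  refine ((lintegral_mono (gradNorm_le hK)).trans_lt ?_).ne
  simpa using ENNReal.mul_lt_top ENNReal.coe_lt_top (measure_lt_top μ univ)

variable [MeasurableSpace Ω] [BorelSpace Ω]

theorem measurable_slopeSup {f : Ω → ℝ} (hf : Continuous f) (r : ℝ) :
    Measurable (slopeSup f r) :=
  (lowerSemicontinuous_slopeSup hf r).measurable

theorem measurable_gradNorm {f : Ω → ℝ} (hf : Continuous f) : Measurable (gradNorm f) := by
  have h : gradNorm f = fun x => ⨅ n : ℕ, slopeSup f (1 / ((n : ℝ) + 1)) x :=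
    funext (gradNorm_eq_iInf f)
  rw [h]
  exact Measurable.iInf fun n => measurable_slopeSup hf _

theorem tendsto_lintegral_slopeSup {f : Ω → ℝ} {K : NNReal} (hf : LipschitzWith K f)
    (μ : Measure Ω) [IsFiniteMeasure μ] :
    Tendsto (fun n : ℕ => ∫⁻ x, slopeSup f (1 / ((n : ℝ) + 1)) x ∂μ) atTop
      (𝓝 (∫⁻ x, gradNorm f x ∂μ)) := by
  refine tendsto_lintegral_of_dominated_convergence (fun _ => (K : ℝ≥0∞))
    (fun n => measurable_slopeSup hf.continuous _)
    (fun n => Eventually.of_forall fun x => slopeSup_le hf _ x) ?_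
    (Eventually.of_forall fun x => tendsto_slopeSup f x)
  simpa using ENNReal.mul_ne_top ENNReal.coe_ne_top (measure_ne_top μ univ)

/-- Integrated over the level, the mass gained by `h`-thickening the superlevel sets is at most
`h` times the integral of the largest difference quotients at scale `h`. -/
theorem lintegral_measure_thickening_diff_le {f : Ω → ℝ} (hf : Continuous f) (μ : Measure Ω)
    [SFinite μ] (h : ℝ) :
    ∫⁻ s : ℝ, μ (Metric.thickening h {x | s < f x} \ {x | s < f x}) ≤
      ∫⁻ x, ENNReal.ofReal h * slopeSup f h x ∂μ := by
  -- The section of `E` at level `s` is the shell gained by thickening; its section at `x` lies in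
  -- an interval starting at `f x`. Writing the thickened part as a union of open boxes makes `E`
  -- Borel.
  let E : Set (Ω × ℝ) := {p | p.2 < f p.1}ᶜ ∩ ⋃ y : Ω, Metric.ball y h ×ˢ Iio (f y)
  have hE : MeasurableSet E := by
    refine MeasurableSet.inter ?_ ?_
    · exact (isOpen_lt continuous_snd (hf.comp continuous_fst)).measurableSet.compl
    · exact (isOpen_iUnion fun y => Metric.isOpen_ball.prod isOpen_Iio).measurableSet
  have h1 : ∀ s : ℝ, (fun x => (x, s)) ⁻¹' E =
      Metric.thickening h {x | s < f x} \ {x | s < f x} := by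
    intro s
    ext x
    simp only [E, mem_preimage, mem_inter_iff, mem_compl_iff, mem_ofPred_eq, mem_iUnion, mem_prod,
      mem_Iio, Set.mem_sdiff, Metric.mem_thickening_iff, Metric.mem_ball]
    constructor
    · rintro ⟨h1, y, h2, h3⟩
      exact ⟨⟨y, h3, h2⟩, h1⟩
    · rintro ⟨⟨y, h3, h2⟩, h1⟩
      exact ⟨h1, y, h2, h3⟩
  have h2 : ∀ x : Ω, volume (Prod.mk x ⁻¹' E) ≤ ENNReal.ofReal h * slopeSup f h x := by
    intro x
    by_cases htop : ENNReal.ofReal h * slopeSup f h x = ∞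
    · simp [htop]
    have hsub : Prod.mk x ⁻¹' E ⊆
        Icc (f x) (f x + (ENNReal.ofReal h * slopeSup f h x).toReal) := by
      rintro s ⟨hs1, hs2⟩
      simp only [mem_compl_iff, mem_ofPred_eq, not_lt] at hs1
      simp only [mem_iUnion, mem_prod, Metric.mem_ball, mem_Iio] at hs2
      obtain ⟨y, hy, hsy⟩ := hs2
      refine ⟨hs1, ?_⟩
      have hne : y ≠ x := by
        rintro rfl
        exact absurd hsy (not_lt.2 hs1)
      have hq : edist (f x) (f y) / edist x y ≤ slopeSup f h x :=
        le_iSup₂_of_le (f := fun y (_ : y ∈ {x}ᶜ ∩ Metric.ball x h) =>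
          edist (f x) (f y) / edist x y) y ⟨hne, Metric.mem_ball'.2 hy⟩ le_rfl
      have hb : edist (f x) (f y) ≤ ENNReal.ofReal h * slopeSup f h x := by
        rw [ENNReal.div_le_iff (by simpa using hne.symm) (edist_ne_top _ _)] at hq
        refine hq.trans ?_
        rw [mul_comm]
        gcongr
        rw [edist_dist]
        exact ENNReal.ofReal_le_ofReal hy.le
      have hb' := ENNReal.toReal_mono htop hb
      rw [edist_dist, ENNReal.toReal_ofReal dist_nonneg, Real.dist_eq] at hb'
      have := (abs_le.1 hb').1
      linarith
    calc volume (Prod.mk x ⁻¹' E)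
        ≤ volume (Icc (f x) (f x + (ENNReal.ofReal h * slopeSup f h x).toReal)) :=
          measure_mono hsub
      _ = ENNReal.ofReal h * slopeSup f h x := by
          rw [Real.volume_Icc, add_sub_cancel_left, ENNReal.ofReal_toReal htop]
  calc ∫⁻ s : ℝ, μ (Metric.thickening h {x | s < f x} \ {x | s < f x})
      = (μ.prod volume) E := by
        rw [Measure.prod_apply_symm hE]
        simp_rw [h1]
    _ = ∫⁻ x, volume (Prod.mk x ⁻¹' E) ∂μ := Measure.prod_apply hE
    _ ≤ _ := lintegral_mono h2

end Slope

/-! ### The distribution function and the signed rearrangement. -/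

section Distribution

variable {Ω : Type*} [MeasurableSpace Ω] (μ : Measure Ω)

theorem distribFn_nonneg (f : Ω → ℝ) (s : ℝ) : 0 ≤ distribFn μ f s := measureReal_nonneg

variable [IsProbabilityMeasure μ]

theorem distribFn_le_one (f : Ω → ℝ) (s : ℝ) : distribFn μ f s ≤ 1 := measureReal_le_one

theorem distribFn_mem_Icc (f : Ω → ℝ) (s : ℝ) : distribFn μ f s ∈ Icc (0 : ℝ) 1 :=
  ⟨distribFn_nonneg μ f s, distribFn_le_one μ f s⟩

theorem ofReal_distribFn (f : Ω → ℝ) (s : ℝ) :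
    ENNReal.ofReal (distribFn μ f s) = μ {x | s < f x} := ofReal_measureReal

theorem distribFn_antitone (f : Ω → ℝ) : Antitone (distribFn μ f) := fun _ _ h =>
  measureReal_mono fun _ hx => lt_of_le_of_lt h hx

theorem measurable_distribFn (f : Ω → ℝ) : Measurable (distribFn μ f) :=
  (distribFn_antitone μ f).measurable

variable {f : Ω → ℝ}

theorem distribFn_eq_one_sub_cdf (hf : Measurable f) (s : ℝ) :
    distribFn μ f s = 1 - ProbabilityTheory.cdf (μ.map f) s := by
  have := Measure.isProbabilityMeasure_map (μ := μ) hf.aemeasurable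
  rw [ProbabilityTheory.cdf_eq_real, map_measureReal_apply hf measurableSet_Iic,
    ← probReal_compl_eq_one_sub (hf measurableSet_Iic), distribFn]
  congr 1
  ext x
  simp

theorem tendsto_distribFn_atTop (hf : Measurable f) : Tendsto (distribFn μ f) atTop (𝓝 0) := by
  have h := (ProbabilityTheory.tendsto_cdf_atTop (μ.map f)).const_sub 1
  rw [sub_self] at h
  exact h.congr fun s => (distribFn_eq_one_sub_cdf μ hf s).symm

theorem tendsto_distribFn_atBot (hf : Measurable f) : Tendsto (distribFn μ f) atBot (𝓝 1) := by
  have h := (ProbabilityTheory.tendsto_cdf_atBot (μ.map f)).const_sub 1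
  rw [sub_zero] at h
  exact h.congr fun s => (distribFn_eq_one_sub_cdf μ hf s).symm

theorem continuousWithinAt_distribFn (hf : Measurable f) (s : ℝ) :
    ContinuousWithinAt (distribFn μ f) (Ici s) s := by
  have h : ContinuousWithinAt (fun s => 1 - ProbabilityTheory.cdf (μ.map f) s) (Ici s) s :=
    continuousWithinAt_const.sub ((ProbabilityTheory.cdf (μ.map f)).right_continuous s)
  exact h.congr (fun s _ => distribFn_eq_one_sub_cdf μ hf s) (distribFn_eq_one_sub_cdf μ hf s)

/-- Right-continuity of `μ_f` is the point: if `μ_f(s) > t`, this persists on some `[s, u)`, so the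
infimum is at least `u > s`. The limits at `±∞` make the infimum one over a nonempty set bounded
below. -/
theorem lt_signedRearr_iff (hf : Measurable f) {t : ℝ} (ht : t ∈ Ioo (0 : ℝ) 1) (s : ℝ) :
    s < signedRearr μ f t ↔ t < distribFn μ f s := by
  obtain ⟨a, ha⟩ := ((tendsto_distribFn_atBot μ hf).eventually (lt_mem_nhds ht.2)).exists
  obtain ⟨b, hb⟩ := ((tendsto_distribFn_atTop μ hf).eventually (gt_mem_nhds ht.1)).exists
  have hbdd : BddBelow {s : ℝ | distribFn μ f s ≤ t} := by
    refine ⟨a, fun s hs => ?_⟩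
    by_contra hlt
    exact absurd (ha.trans_le (distribFn_antitone μ f (not_le.1 hlt).le)) (not_lt.2 hs)
  have hne : {s : ℝ | distribFn μ f s ≤ t}.Nonempty := ⟨b, hb.le⟩
  constructor
  · intro h
    by_contra hlt
    exact absurd (csInf_le hbdd (not_lt.1 hlt)) (not_le.2 h)
  · intro h
    have hev := (continuousWithinAt_distribFn μ hf s).eventually (lt_mem_nhds h)
    obtain ⟨u, hu, hsub⟩ := (mem_nhdsGE_iff_exists_Ico_subset).1 hev
    refine lt_of_lt_of_le hu (le_csInf hne fun r hr => ?_)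
    by_contra hlt
    have hr' : r < u := not_le.1 hlt
    rcases lt_or_ge r s with hrs | hrs
    · exact absurd (h.trans_le (distribFn_antitone μ f hrs.le)) (not_lt.2 hr)
    · exact absurd (show t < distribFn μ f r from hsub ⟨hrs, hr'⟩) (not_lt.2 hr)

theorem signedRearr_antitoneOn (hf : Measurable f) :
    AntitoneOn (signedRearr μ f) (Ioo 0 1) := by
  intro a ha b hb hab
  refine le_of_forall_lt fun s hs => ?_
  rw [lt_signedRearr_iff μ hf ha]
  exact hab.trans_lt ((lt_signedRearr_iff μ hf hb s).1 hs)

/-- `signedRearr μ f`, as a random variable on `(0,1)`, has the same law as `f`. -/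
theorem map_signedRearr (hf : Measurable f) :
    (volume.restrict (Ioo (0 : ℝ) 1)).map (signedRearr μ f) = μ.map f := by
  have hm : AEMeasurable (signedRearr μ f) (volume.restrict (Ioo (0 : ℝ) 1)) :=
    aemeasurable_restrict_of_antitoneOn measurableSet_Ioo (signedRearr_antitoneOn μ hf)
  have := Measure.isProbabilityMeasure_map (μ := μ) hf.aemeasurable
  have hp : IsProbabilityMeasure (volume.restrict (Ioo (0 : ℝ) 1)) := ⟨by simp⟩
  have := Measure.isProbabilityMeasure_map hm
  refine Measure.ext_of_Iic _ _ fun s => ?_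
  rw [← compl_Ioi, prob_compl_eq_one_sub measurableSet_Ioi, prob_compl_eq_one_sub measurableSet_Ioi]
  congr 1
  rw [Measure.map_apply_of_aemeasurable hm measurableSet_Ioi,
    Measure.map_apply hf measurableSet_Ioi, Measure.restrict_apply₀' measurableSet_Ioo.nullMeasurableSet]
  have h : signedRearr μ f ⁻¹' Ioi s ∩ Ioo 0 1 = Ioo 0 (distribFn μ f s) := by
    ext t
    constructor
    · rintro ⟨h1, h2⟩
      exact ⟨h2.1, (lt_signedRearr_iff μ hf h2 s).1 h1⟩
    · rintro ⟨h1, h2⟩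
      have h3 : t ∈ Ioo (0 : ℝ) 1 := ⟨h1, h2.trans_le (distribFn_le_one μ f s)⟩
      exact ⟨(lt_signedRearr_iff μ hf h3 s).2 h2, h3⟩
  rw [h, Real.volume_Ioo, sub_zero, ofReal_distribFn]
  rfl

end Distribution

/-! ### Convex estimators and the function `β₁`. -/

section Estimator

variable {I : ℝ → ℝ}

theorem IsConvexEstimator.one (hI : IsConvexEstimator I) : I 1 = 0 := by
  have h := hI.symm 0 ⟨le_rfl, zero_le_one⟩
  rw [sub_zero] at h
  rw [h, hI.zero]

theorem IsConvexEstimator.measurable_comp (hI : IsConvexEstimator I) {α : Type*}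
    [MeasurableSpace α] {g : α → ℝ} (hg : Measurable g) (h01 : ∀ x, g x ∈ Icc (0 : ℝ) 1) :
    Measurable fun x => I (g x) := by
  have h : Measurable ((Icc (0 : ℝ) 1).domRestrict I) :=
    (continuousOn_iff_continuous_domRestrict.1 hI.continuousOn).measurable
  exact h.comp (hg.subtype_mk (h := h01))

theorem IsConvexEstimator.le_half (hI : IsConvexEstimator I) {s t : ℝ} (hs : 0 < s) (hst : s ≤ t)
    (ht : t ≤ 1 / 2) : I s ≤ I t := by
  rcases ht.lt_or_eq with h | rfl
  · exact hI.monotoneOn ⟨hs, hst.trans_lt h⟩ ⟨hs.trans_le hst, h⟩ hst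
  rcases hst.lt_or_eq with h | rfl
  swap
  · exact le_rfl
  have hc : ContinuousWithinAt I (Ioo s (1 / 2)) (1 / 2) :=
    (hI.continuousOn (1 / 2) (by norm_num)).mono fun x hx =>
      ⟨hs.le.trans hx.1.le, hx.2.le.trans (by norm_num)⟩
  have hne : (𝓝[Ioo s (1 / 2)] (1 / 2 : ℝ)).NeBot := by
    rw [← mem_closure_iff_nhdsWithin_neBot, closure_Ioo h.ne]
    exact right_mem_Icc.2 h.le
  refine ge_of_tendsto hc ?_
  filter_upwards [self_mem_nhdsWithin] with x hx
  exact hI.monotoneOn ⟨hs, h⟩ ⟨hs.trans hx.1, hx.2⟩ hx.1.le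

theorem IsConvexEstimator.betaOne_nonneg (hI : IsConvexEstimator I) {s : ℝ} (hs : 0 < s) :
    0 ≤ betaOne I s := by
  refine Real.sSup_nonneg ?_
  rintro _ ⟨t, ht, rfl⟩
  exact div_nonneg (sub_nonneg.2 ht.1.le)
    (hI.nonneg t ⟨hs.le.trans ht.1.le, ht.2.trans (by norm_num)⟩)

theorem IsConvexEstimator.le_betaOne_mul_add (hI : IsConvexEstimator I) {s t : ℝ} (hs : 0 < s)
    (ht0 : 0 ≤ t) (ht : t ≤ 1 / 2) : t ≤ betaOne I s * I t + s := by
  rcases le_or_gt t s with hts | hst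
  · have := mul_nonneg (hI.betaOne_nonneg hs) (hI.nonneg t ⟨ht0, ht.trans (by norm_num)⟩)
    linarith
  have hIs : 0 < I s := hI.pos s ⟨hs, by linarith⟩
  have hIt : 0 < I t := hI.pos t ⟨hs.trans hst, by linarith⟩
  -- Without this bound the real `sSup` could be the default value `0`; monotonicity of `I` supplies
  -- it.
  have hbdd : BddAbove ((fun t => (t - s) / I t) '' Ioc s (1 / 2)) := by
    refine ⟨1 / I s, ?_⟩
    rintro _ ⟨r, hr, rfl⟩
    have := hI.le_half hs hr.1.le hr.2
    exact div_le_div₀ zero_le_one (by linarith [hr.2]) hIs this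
  have h := le_csSup hbdd ⟨t, ⟨hst, ht⟩, rfl⟩
  have h' := (div_le_iff₀ hIt).1 h
  rw [betaOne]
  linarith

/-- A lower bound by `β₁` at every `s > 0` recovers the convex function `I`. -/
theorem IsConvexEstimator.le_of_forall_betaOne (hI : IsConvexEstimator I) {t c : ℝ} (ht0 : 0 < t)
    (ht : t ≤ 1 / 2) (h : ∀ s, 0 < s → t ≤ betaOne I s * c + s) (hc : 0 ≤ c) : I t ≤ c := by
  -- A supporting line is taken at an interior point, and `t` may equal `1/2`; hence `r < t` first,
  -- then continuity as `r → t`.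
  have key : ∀ r ∈ Ioo 0 t, I r ≤ c := by
    intro r hr
    have hr2 : r < 1 / 2 := hr.2.trans_le ht
    have hrmem : r ∈ Icc (0 : ℝ) (1 / 2) := ⟨hr.1.le, hr2.le⟩
    have hint : r ∈ interior (Icc (0 : ℝ) (1 / 2)) := by
      rw [interior_Icc]
      exact ⟨hr.1, hr2⟩
    have hIr : 0 < I r := hI.pos r ⟨hr.1, by linarith⟩
    obtain ⟨k, hk⟩ : ∃ k, ∀ x ∈ Icc (0 : ℝ) (1 / 2), I r + k * (x - r) ≤ I x := by
      refine ⟨derivWithin I (Ioi r) r, fun x hx => ?_⟩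
      rcases lt_trichotomy x r with hlt | rfl | hgt
      · have h1 := hI.convexOn.slope_le_leftDeriv_of_mem_interior hx hint hlt
        have h2 := h1.trans (hI.convexOn.leftDeriv_le_rightDeriv_of_mem_interior hint)
        rw [slope_def_field, div_le_iff₀ (sub_pos.2 hlt)] at h2
        linarith
      · simp
      · have h1 := hI.convexOn.rightDeriv_le_slope_of_mem_interior hint hx hgt
        rw [slope_def_field, le_div_iff₀ (sub_pos.2 hgt)] at h1
        linarith
    have hk0 := hk 0 ⟨le_rfl, by norm_num⟩
    rw [hI.zero] at hk0
    have hkpos : 0 < k := by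
      by_contra hneg
      have : k * r ≤ 0 := mul_nonpos_of_nonpos_of_nonneg (not_lt.1 hneg) hr.1.le
      nlinarith
    -- The zero of the supporting line at `r`. For `s > z` one has `I x ≥ k (x - z) ≥ k (x - s)`, so
    -- `β₁(s) ≤ 1/k`; letting `s → z` gives `c ≥ k (t - z) = I r + k (t - r)`.
    set z := r - I r / k with hz
    have hkz : k * z = k * r - I r := by
      rw [hz]
      field_simp
    have hz0 : 0 ≤ z := by
      by_contra hneg
      have := mul_neg_of_pos_of_neg hkpos (not_le.1 hneg)
      linarith
    have hbeta : ∀ s, z < s → betaOne I s ≤ 1 / k := by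
      intro s hs
      refine Real.sSup_le ?_ (one_div_nonneg.2 hkpos.le)
      rintro _ ⟨x, hx, rfl⟩
      have hx0 : 0 < x := (hz0.trans_lt hs).trans hx.1
      have hIx : 0 < I x := hI.pos x ⟨hx0, by linarith [hx.2]⟩
      have := hk x ⟨hx0.le, hx.2⟩
      have hks := mul_lt_mul_of_pos_left hs hkpos
      refine (div_le_div_iff₀ hIx hkpos).2 ?_
      nlinarith
    have hfin : ∀ s, z < s → t ≤ 1 / k * c + s := fun s hs =>
      (h s (hz0.trans_lt hs)).trans
        (add_le_add_left (mul_le_mul_of_nonneg_right (hbeta s hs) hc) s)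
    have hlim : t - 1 / k * c ≤ z := le_of_forall_gt fun s hs => by
      have h1 := hfin ((z + s) / 2) (by linarith)
      linarith
    have h2 := mul_le_mul_of_nonneg_left hlim hkpos.le
    have h3 : k * (t - 1 / k * c) = k * t - c := by field_simp
    have h4 := mul_lt_mul_of_pos_left hr.2 hkpos
    linarith
  have hcont : ContinuousWithinAt I (Ioo 0 t) t :=
    (hI.continuousOn t ⟨ht0.le, by linarith⟩).mono fun x hx => ⟨hx.1.le, by linarith [hx.2]⟩
  have hne : (𝓝[Ioo 0 t] t).NeBot := by
    rw [← mem_closure_iff_nhdsWithin_neBot, closure_Ioo ht0.ne]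
    exact right_mem_Icc.2 ht0.le
  refine le_of_tendsto hcont ?_
  filter_upwards [self_mem_nhdsWithin] with x hx using key x hx

theorem IsConvexEstimator.min_eq (hI : IsConvexEstimator I) {t : ℝ} (ht : t ∈ Icc (0 : ℝ) 1) :
    I (min t (1 - t)) = I t := by
  rcases min_choice t (1 - t) with h | h <;> rw [h]
  exact hI.symm t ht

end Estimator

/-! ### From the isoperimetric inequality to Ledoux's inequality. -/

section Coarea

variable {Ω : Type*} [MetricSpace Ω] [MeasurableSpace Ω] [BorelSpace Ω] {μ : Measure Ω}
  [IsProbabilityMeasure μ] {I : ℝ → ℝ}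

theorem ledouxIneq_of_isoperimetricIneq (h : IsoperimetricIneq μ I) :
    LedouxIneq μ I := by
  rintro f ⟨K, hK⟩
  have hf := hK.continuous
  -- Fatou's lemma needs a sequence; the Minkowski content is at most the liminf along any sequence
  -- of positive scales tending to `0`.
  let e : ℕ → ℝ := fun n => 1 / ((n : ℝ) + 1)
  have he : ∀ n, 0 < e n := fun n => Nat.one_div_pos_of_nat
  have hT : Tendsto e atTop (𝓝[>] 0) :=
    tendsto_nhdsWithin_iff.2
      ⟨tendsto_one_div_add_atTop_nhds_zero_nat, Eventually.of_forall he⟩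
  let q : ℕ → ℝ → ℝ≥0∞ := fun n s =>
    (μ (Metric.thickening (e n) {x | s < f x}) - μ {x | s < f x}) / ENNReal.ofReal (e n)
  have hq : ∀ n, Measurable (q n) := by
    intro n
    have h1 : Antitone fun s => μ (Metric.thickening (e n) {x | s < f x}) := fun a b hab =>
      measure_mono (Metric.thickening_subset_of_subset _ fun x hx => lt_of_le_of_lt hab hx)
    have h2 : Antitone fun s => μ {x | s < f x} := fun a b hab =>
      measure_mono fun x hx => lt_of_le_of_lt hab hx
    exact (h1.measurable.sub h2.measurable).div_const _
  have hpt : ∀ s, ENNReal.ofReal (I (distribFn μ f s)) ≤ liminf (fun n => q n s) atTop := by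
    intro s
    refine (h {x | s < f x} (measurableSet_lt measurable_const hf.measurable)).trans ?_
    exact liminf_le_liminf_of_le hT
  have hint : ∀ n, ∫⁻ s, q n s ≤ ∫⁻ x, slopeSup f (e n) x ∂μ := by
    intro n
    have h0 : ENNReal.ofReal (e n) ≠ 0 := by simpa using he n
    have h1 : ∀ s, q n s = μ (Metric.thickening (e n) {x | s < f x} \ {x | s < f x}) /
        ENNReal.ofReal (e n) := by
      intro s
      simp only [q]
      rw [measure_sdiff (Metric.self_subset_thickening (he n) _)
        (measurableSet_lt measurable_const hf.measurable).nullMeasurableSet (measure_ne_top _ _)]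
    simp_rw [h1, div_eq_mul_inv]
    rw [lintegral_mul_const' _ _ (ENNReal.inv_ne_top.2 h0), ← div_eq_mul_inv]
    refine ENNReal.div_le_of_le_mul' ?_
    refine (lintegral_measure_thickening_diff_le hf μ (e n)).trans ?_
    rw [lintegral_const_mul' _ _ ENNReal.ofReal_ne_top]
  calc ∫⁻ s : ℝ, ENNReal.ofReal (I (distribFn μ f s))
      ≤ ∫⁻ s, liminf (fun n => q n s) atTop := lintegral_mono hpt
    _ ≤ liminf (fun n => ∫⁻ s, q n s) atTop := lintegral_liminf_le hq
    _ ≤ liminf (fun n => ∫⁻ x, slopeSup f (e n) x ∂μ) atTop :=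
        liminf_le_liminf (Eventually.of_forall hint)
    _ = ∫⁻ x, gradNorm f x ∂μ := (tendsto_lintegral_slopeSup hK μ).liminf_eq

end Coarea

/-! ### Existence of a median and bounds on the oscillation. -/

section Median

variable {Ω : Type*} [MeasurableSpace Ω] {μ : Measure Ω} [IsProbabilityMeasure μ] {f : Ω → ℝ}

/-- Equality of laws moves the question to `(0,1)`, where a decreasing function is at least its
midpoint value on `(0,1/2]` and at most that value on `[1/2,1)`. -/
theorem isMedianOf_signedRearr (hf : Measurable f) : IsMedianOf μ f (signedRearr μ f (1 / 2)) := by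
  have hanti := signedRearr_antitoneOn μ hf
  have hm : AEMeasurable (signedRearr μ f) (volume.restrict (Ioo (0 : ℝ) 1)) :=
    aemeasurable_restrict_of_antitoneOn measurableSet_Ioo hanti
  have hmem : (1 / 2 : ℝ) ∈ Ioo (0 : ℝ) 1 := by norm_num
  have hlaw : ∀ E : Set ℝ, MeasurableSet E →
      μ (f ⁻¹' E) = volume (signedRearr μ f ⁻¹' E ∩ Ioo 0 1) := by
    intro E hE
    rw [← Measure.map_apply hf hE, ← map_signedRearr μ hf, Measure.map_apply_of_aemeasurable hm hE,
      Measure.restrict_apply₀' measurableSet_Ioo.nullMeasurableSet]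
  have hhalf : ENNReal.ofReal (1 / 2) = 1 / 2 := by
    rw [ENNReal.ofReal_div_of_pos two_pos]
    simp
  constructor
  · calc (1 / 2 : ℝ≥0∞) = volume (Ioc (0 : ℝ) (1 / 2)) := by
          rw [Real.volume_Ioc, sub_zero, hhalf]
      _ ≤ volume (signedRearr μ f ⁻¹' Ici (signedRearr μ f (1 / 2)) ∩ Ioo 0 1) := by
          refine measure_mono fun t ht => ?_
          have ht' : t ∈ Ioo (0 : ℝ) 1 := ⟨ht.1, ht.2.trans_lt (by norm_num)⟩
          exact ⟨hanti ht' hmem ht.2, ht'⟩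
      _ = _ := (hlaw _ measurableSet_Ici).symm
  · calc (1 / 2 : ℝ≥0∞) = volume (Ico (1 / 2 : ℝ) 1) := by
          rw [Real.volume_Ico, ← hhalf]
          norm_num
      _ ≤ volume (signedRearr μ f ⁻¹' Iic (signedRearr μ f (1 / 2)) ∩ Ioo 0 1) := by
          refine measure_mono fun t ht => ?_
          have ht' : t ∈ Ioo (0 : ℝ) 1 := ⟨lt_of_lt_of_le (by norm_num) ht.1, ht.2⟩
          exact ⟨hanti hmem ht' ht.1, ht'⟩
      _ = _ := (hlaw _ measurableSet_Iic).symm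

theorem signedRearr_mem_Icc (hf : Measurable f) {a b : ℝ} (h : ∀ x, f x ∈ Icc a b) {t : ℝ}
    (ht : t ∈ Ioo (0 : ℝ) 1) : signedRearr μ f t ∈ Icc a b := by
  constructor
  · by_contra hlt
    have h1 := (lt_signedRearr_iff μ hf ht (signedRearr μ f t)).not.1 (lt_irrefl _)
    have h2 : {x | signedRearr μ f t < f x} = univ :=
      eq_univ_of_forall fun x => (not_le.1 hlt).trans_le (h x).1
    rw [distribFn, h2, probReal_univ] at h1
    exact h1 ht.2
  · by_contra hlt
    have h1 := (lt_signedRearr_iff μ hf ht b).1 (not_le.1 hlt)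
    have h2 : {x | b < f x} = ∅ := eq_empty_of_forall_notMem fun x hx => absurd hx (not_lt.2 (h x).2)
    rw [distribFn, h2, measureReal_empty] at h1
    exact absurd h1 (not_lt.2 ht.1.le)

theorem oscOf_le {a b : ℝ} (h : ∀ x, f x ∈ Icc a b) : oscOf μ f ≤ b - a := by
  have hbot : IsBoundedUnder (· ≥ ·) (ae μ) f :=
    isBoundedUnder_of_eventually_ge (Eventually.of_forall fun x => (h x).1)
  have htop : IsBoundedUnder (· ≤ ·) (ae μ) f :=
    isBoundedUnder_of_eventually_le (Eventually.of_forall fun x => (h x).2)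
  have h1 : essSup f μ ≤ b :=
    limsup_le_of_le hbot.isCoboundedUnder_le (Eventually.of_forall fun x => (h x).2)
  have h2 : a ≤ essInf f μ :=
    le_liminf_of_le htop.isCoboundedUnder_ge (Eventually.of_forall fun x => (h x).1)
  rw [oscOf]
  linarith

end Median

/-! ### Tent functions, and from Bobkov's inequality back to isoperimetry. -/

section TestFunction

variable {Ω : Type*} [MetricSpace Ω]

/-- The Lipschitz function equal to `1` on `A` and to `0` off the `h`-neighbourhood of `A`, affine
in the distance to `A` in between. -/
noncomputable def tentFn (A : Set Ω) (h : ℝ) (x : Ω) : ℝ := max 0 (1 - Metric.infDist x A / h)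

theorem lipschitzWith_tentFn (A : Set Ω) {h : ℝ} (hh : 0 < h) :
    LipschitzWith (Real.toNNReal (1 / h)) (tentFn A h) := by
  refine LipschitzWith.of_dist_le_mul fun x y => ?_
  rw [Real.coe_toNNReal _ (one_div_nonneg.2 hh.le), Real.dist_eq, tentFn, tentFn]
  have h1 := abs_max_sub_max_le_abs (1 - Metric.infDist x A / h) (1 - Metric.infDist y A / h) 0
  rw [max_comm, max_comm 0]
  refine h1.trans ?_
  have h2 := (Metric.lipschitz_infDist_pt A).dist_le_mul x y
  rw [Real.dist_eq, NNReal.coe_one, one_mul] at h2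
  rw [show 1 - Metric.infDist x A / h - (1 - Metric.infDist y A / h) =
    -(1 / h * (Metric.infDist x A - Metric.infDist y A)) by ring, abs_neg, abs_mul,
    abs_of_pos (one_div_pos.2 hh)]
  exact mul_le_mul_of_nonneg_left h2 (one_div_nonneg.2 hh.le)

theorem tentFn_mem_Icc (A : Set Ω) {h : ℝ} (hh : 0 < h) (x : Ω) : tentFn A h x ∈ Icc (0 : ℝ) 1 :=
  ⟨le_max_left _ _, max_le zero_le_one (by
    have := div_nonneg (Metric.infDist_nonneg (x := x) (s := A)) hh.le
    linarith)⟩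

theorem tentFn_of_mem {A : Set Ω} {x : Ω} (hx : x ∈ A) (h : ℝ) : tentFn A h x = 1 := by
  simp [tentFn, Metric.infDist_zero_of_mem hx]

theorem tentFn_of_notMem {A : Set Ω} (hA : A.Nonempty) {h : ℝ} (hh : 0 < h) {x : Ω}
    (hx : x ∉ Metric.thickening h A) : tentFn A h x = 0 := by
  have hx' : h ≤ Metric.infDist x A := by
    refine (Metric.le_infDist hA).2 fun y hy => ?_
    by_contra hlt
    exact hx (Metric.mem_thickening_iff.2 ⟨y, hy, not_le.1 hlt⟩)
  exact max_eq_left (by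
    have := (one_le_div hh).2 hx'
    linarith)

variable [MeasurableSpace Ω] {μ : Measure Ω} [IsProbabilityMeasure μ] {I : ℝ → ℝ}

theorem exists_thickening_of_minkowskiContent_lt {A : Set Ω} {c : NNReal}
    (hc : minkowskiContent μ A < c) {η : ℝ} (hη : 0 < η) :
    ∃ h : ℝ, 0 < h ∧ (μ (Metric.thickening h A) - μ A) / ENNReal.ofReal h < c ∧
      μ.real (Metric.thickening h A) < μ.real A + η := by
  have hfreq : ∃ᶠ h : ℝ in 𝓝[>] 0,
      (μ (Metric.thickening h A) - μ A) / ENNReal.ofReal h < c :=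
    frequently_lt_of_liminf_lt (by isBoundedDefault) hc
  -- Taking `h < η / (c + 1)` forces `c h < η`; the `+ 1` covers `c = 0`.
  have hpos : (0 : ℝ) < η / (c + 1) := by positivity
  obtain ⟨h, h1, h2⟩ := (hfreq.and_eventually (Ioo_mem_nhdsGT hpos)).exists
  have hh : 0 < h := h2.1
  refine ⟨h, hh, h1, ?_⟩
  have h3 : μ (Metric.thickening h A) - μ A ≤ c * ENNReal.ofReal h := by
    rw [← ENNReal.div_le_iff (by simpa using hh) ENNReal.ofReal_ne_top]
    exact h1.le
  have h4 : μ (Metric.thickening h A) ≤ c * ENNReal.ofReal h + μ A := tsub_le_iff_right.1 h3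
  have h5 := ENNReal.toReal_mono (by finiteness) h4
  rw [ENNReal.toReal_add (by finiteness) (by finiteness), ENNReal.toReal_mul,
    ENNReal.toReal_ofReal hh.le, ENNReal.coe_toReal] at h5
  have h6 : (c : ℝ) * h < η := by
    have := (lt_div_iff₀ (by positivity)).1 h2.2
    nlinarith
  change (μ (Metric.thickening h A)).toReal < (μ A).toReal + η
  linarith

/-- Since `I` vanishes at `0` and `1`, only sets of intermediate mass matter, and comparing with
finite `c` above the content avoids the value `∞`. -/
theorem isoperimetricIneq_of_forall_le (hI : IsConvexEstimator I)
    (h : ∀ A : Set Ω, MeasurableSet A → A.Nonempty → 0 < μ.real A → μ.real A < 1 → ∀ c : NNReal,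
      minkowskiContent μ A < c → I (μ.real A) ≤ c) : IsoperimetricIneq μ I := by
  intro A hA
  by_contra hlt
  obtain ⟨c, hc1, hc2⟩ := ENNReal.lt_iff_exists_nnreal_btwn.1 (not_le.1 hlt)
  have hIpos : (c : ℝ) < I (μ.real A) := by
    rw [← ENNReal.ofReal_coe_nnreal] at hc2
    exact (ENNReal.ofReal_lt_ofReal_iff_of_nonneg c.2).1 hc2
  have hI0 : I (μ.real A) ≠ 0 := (c.2.trans_lt hIpos).ne'
  have h0 : 0 < μ.real A :=
    measureReal_nonneg.lt_of_ne fun h => hI0 (by rw [← h, hI.zero])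
  have h1 : μ.real A < 1 := measureReal_le_one.lt_of_ne fun h => hI0 (by rw [h, hI.one])
  have hne : A.Nonempty := by
    rw [nonempty_iff_ne_empty]
    rintro rfl
    simp at h0
  exact absurd (h A hA hne h0 h1 c hc1) (not_le.2 hIpos)

variable [BorelSpace Ω]

/-- The tent is `1` on `A` and `0` off the thickening, so its gradient vanishes almost everywhere
there by the hypothesis on level sets, boundary points included; on the shell the Lipschitz bound
`1/h` applies. -/
theorem lintegral_gradNorm_tentFn_le (hμ : GradVanishesOnLevels μ) {A : Set Ω}
    (hAm : MeasurableSet A) (hA : A.Nonempty) {h : ℝ} (hh : 0 < h) :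
    ∫⁻ x, gradNorm (tentFn A h) x ∂μ ≤
      (μ (Metric.thickening h A) - μ A) / ENNReal.ofReal h := by
  have hlip := lipschitzWith_tentFn A hh
  have hT : MeasurableSet (Metric.thickening h A) := Metric.isOpen_thickening.measurableSet
  have hae : ∀ᵐ x ∂μ, gradNorm (tentFn A h) x ≤
      (Metric.thickening h A \ A).indicator (fun _ => (ENNReal.ofReal h)⁻¹) x := by
    filter_upwards [hμ _ ⟨_, hlip⟩ 0, hμ _ ⟨_, hlip⟩ 1] with x h0 h1
    by_cases hxA : x ∈ A
    · rw [h1 (tentFn_of_mem hxA h)]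
      exact zero_le
    by_cases hxT : x ∈ Metric.thickening h A
    · rw [indicator_of_mem (show x ∈ Metric.thickening h A \ A from ⟨hxT, hxA⟩),
        ← ENNReal.ofReal_inv_of_pos hh]
      refine (gradNorm_le hlip x).trans_eq ?_
      rw [one_div]
      rfl
    · rw [h0 (tentFn_of_notMem hA hh hxT)]
      exact zero_le
  refine (lintegral_mono_ae hae).trans_eq ?_
  rw [lintegral_indicator_const (hT.diff hAm), measure_sdiff
    (Metric.self_subset_thickening hh A) hAm.nullMeasurableSet (measure_ne_top _ _), mul_comm,
    div_eq_mul_inv]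

/-- The tent minus its median `m` has oscillation at most `1`, gradient integral at most `c`, and
`L¹` norm at least `(1 - m) μ(A) + m (1 - μ(A_h))`. This is nearly a convex combination of `μ(A)`
and `1 - μ(A)`, hence at least their minimum up to `η`. -/
theorem isoperimetricIneq_of_bobkovIneq (hμ : GradVanishesOnLevels μ) (hI : IsConvexEstimator I)
    (hB : BobkovIneq μ I) : IsoperimetricIneq μ I := by
  refine isoperimetricIneq_of_forall_le hI fun A hA hne h0 h1 c hc => ?_
  rw [← hI.min_eq ⟨h0.le, h1.le⟩]
  set a := μ.real A with ha
  refine hI.le_of_forall_betaOne (lt_min h0 (sub_pos.2 h1)) ?_ (fun s hs => ?_) c.coe_nonneg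
  · rcases le_total a (1 / 2) with h | h
    · exact (min_le_left _ _).trans h
    · exact (min_le_right _ _).trans (by linarith)
  refine le_of_forall_pos_le_add fun η hη => ?_
  obtain ⟨h, hh, hq, hT⟩ := exists_thickening_of_minkowskiContent_lt hc hη
  set T := Metric.thickening h A
  have hTm : MeasurableSet T := Metric.isOpen_thickening.measurableSet
  have hlip := lipschitzWith_tentFn A hh
  have hmeas := hlip.continuous.measurable
  set m := signedRearr μ (tentFn A h) (1 / 2)
  have hm : m ∈ Icc (0 : ℝ) 1 :=
    signedRearr_mem_Icc hmeas (tentFn_mem_Icc A hh) (by norm_num)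
  have hmed : IsMedianOf μ (tentFn A h) m := isMedianOf_signedRearr hmeas
  let g : Ω → ℝ := fun x => tentFn A h x - m
  have hgrange : ∀ x, g x ∈ Icc (-m) (1 - m) := fun x => by
    have := tentFn_mem_Icc A hh x
    exact ⟨by simp only [g]; linarith [this.1], by simp only [g]; linarith [this.2]⟩
  have hglip : IsLip g := ⟨_, by
    simpa [g] using hlip.sub (LipschitzWith.const m)⟩
  have hgrad : ∀ x, gradNorm g x ≤ gradNorm (tentFn A h) x :=
    gradNorm_mono fun x y => by simp [g]
  have hgmed : IsMedianOf μ g 0 := by simpa [IsMedianOf, g] using hmed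
  have hbob := hB g hglip ⟨1, fun x => abs_le.2
    ⟨by linarith [(hgrange x).1, hm.2], by linarith [(hgrange x).2, hm.1]⟩⟩ hgmed s hs
  have hosc : s * oscOf μ g ≤ s := by
    have := oscOf_le (μ := μ) hgrange
    nlinarith
  have hupper : ∫⁻ x, ‖g x‖ₑ ∂μ ≤ ENNReal.ofReal (betaOne I s * c + s) := by
    rw [ENNReal.ofReal_add (mul_nonneg (hI.betaOne_nonneg hs) c.coe_nonneg) hs.le,
      ENNReal.ofReal_mul (hI.betaOne_nonneg hs), ENNReal.ofReal_coe_nnreal]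
    refine hbob.trans (add_le_add ?_ (ENNReal.ofReal_le_ofReal hosc))
    gcongr
    exact ((lintegral_mono hgrad).trans (lintegral_gradNorm_tentFn_le hμ hA hne hh)).trans hq.le
  have hlower : ENNReal.ofReal ((1 - m) * a + m * (1 - μ.real T)) ≤ ∫⁻ x, ‖g x‖ₑ ∂μ := by
    have hdisj : Disjoint A Tᶜ :=
      disjoint_compl_right_iff_subset.2 (Metric.self_subset_thickening hh A)
    have hTr : 1 - μ.real T = μ.real Tᶜ := (probReal_compl_eq_one_sub hTm).symm
    rw [hTr, ENNReal.ofReal_add (mul_nonneg (sub_nonneg.2 hm.2) h0.le)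
      (mul_nonneg hm.1 measureReal_nonneg), ENNReal.ofReal_mul (sub_nonneg.2 hm.2),
      ENNReal.ofReal_mul hm.1, ofReal_measureReal, ofReal_measureReal]
    calc ENNReal.ofReal (1 - m) * μ A + ENNReal.ofReal m * μ Tᶜ
        = ∫⁻ x in A, ENNReal.ofReal (1 - m) ∂μ + ∫⁻ x in Tᶜ, ENNReal.ofReal m ∂μ := by simp
      _ ≤ ∫⁻ x in A, ‖g x‖ₑ ∂μ + ∫⁻ x in Tᶜ, ‖g x‖ₑ ∂μ := by
          refine add_le_add (setLIntegral_mono' hA fun x hx => ?_)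
            (setLIntegral_mono' hTm.compl fun x hx => ?_)
          · rw [Real.enorm_eq_ofReal_abs]
            refine ENNReal.ofReal_le_ofReal ?_
            simp only [g]
            rw [tentFn_of_mem hx]
            exact le_abs_self _
          · rw [Real.enorm_eq_ofReal_abs]
            refine ENNReal.ofReal_le_ofReal ?_
            simp only [g]
            rw [tentFn_of_notMem hne hh hx, zero_sub, abs_neg]
            exact le_abs_self _
      _ = ∫⁻ x in A ∪ Tᶜ, ‖g x‖ₑ ∂μ := (lintegral_union hTm.compl hdisj).symm
      _ ≤ _ := setLIntegral_le_lintegral _ _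
  have hfinal := (ENNReal.ofReal_le_ofReal_iff
    (add_nonneg (mul_nonneg (hI.betaOne_nonneg hs) c.coe_nonneg) hs.le)).1 (hlower.trans hupper)
  have hmin1 : min a (1 - a) ≤ a := min_le_left _ _
  have hmin2 : min a (1 - a) ≤ 1 - a := min_le_right _ _
  have e1 := mul_le_mul_of_nonneg_left hmin1 (sub_nonneg.2 hm.2)
  have e2 := mul_le_mul_of_nonneg_left (show min a (1 - a) - η ≤ 1 - μ.real T by linarith) hm.1
  have e3 := mul_nonneg (sub_nonneg.2 hm.2) hη.le
  nlinarith

end TestFunction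

/-! ### From Ledoux's inequality to Bobkov's inequality. -/

section Bobkov

variable {I : ℝ → ℝ}

/-- A tail function `p ≤ 1/2` vanishing beyond `L` satisfies Bobkov's inequality on the half-line. -/
theorem IsConvexEstimator.setLIntegral_tail_le (hI : IsConvexEstimator I) {σ : ℝ} (hσ : 0 < σ)
    {p : ℝ → ℝ} {L : ℝ} (hp : ∀ s, 0 < s → p s ∈ Icc (0 : ℝ) (1 / 2))
    (hL : ∀ s, L < s → p s = 0) :
    ∫⁻ s in Ioi 0, ENNReal.ofReal (p s) ≤
      ENNReal.ofReal (betaOne I σ) * (∫⁻ s in Ioi 0, ENNReal.ofReal (I (p s))) +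
        ENNReal.ofReal (σ * L) := by
  have hpt : ∀ s ∈ Ioi (0 : ℝ), ENNReal.ofReal (p s) ≤
      ENNReal.ofReal (betaOne I σ) * ENNReal.ofReal (I (p s)) +
        (Ioc 0 L).indicator (fun _ => ENNReal.ofReal σ) s := by
    intro s hs
    by_cases hsL : s ≤ L
    · rw [indicator_of_mem (show s ∈ Ioc 0 L from ⟨hs, hsL⟩),
        ← ENNReal.ofReal_mul (hI.betaOne_nonneg hσ),
        ← ENNReal.ofReal_add (mul_nonneg (hI.betaOne_nonneg hσ) (hI.nonneg _
          ⟨(hp s hs).1, (hp s hs).2.trans (by norm_num)⟩)) hσ.le]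
      exact ENNReal.ofReal_le_ofReal (hI.le_betaOne_mul_add hσ (hp s hs).1 (hp s hs).2)
    · rw [hL s (not_le.1 hsL), ENNReal.ofReal_zero]
      exact zero_le
  refine (setLIntegral_mono' measurableSet_Ioi hpt).trans ?_
  rw [lintegral_add_right _ (measurable_const.indicator measurableSet_Ioc),
    lintegral_const_mul' _ _ ENNReal.ofReal_ne_top, lintegral_indicator_const measurableSet_Ioc]
  gcongr
  rw [ENNReal.ofReal_mul hσ.le]
  gcongr
  refine (Measure.restrict_apply_le _ _).trans ?_
  rw [Real.volume_Ioc, sub_zero]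

variable {Ω : Type*} [MetricSpace Ω] [MeasurableSpace Ω] [BorelSpace Ω] {μ : Measure Ω}
  [IsProbabilityMeasure μ]

theorem bobkovIneq_of_ledouxIneq (hI : IsConvexEstimator I) (hL : LedouxIneq μ I) :
    BobkovIneq μ I := by
  rintro f hf ⟨C, hC⟩ ⟨hmed1, hmed2⟩ σ hσ
  obtain ⟨K, hK⟩ := id hf
  have hm : Measurable f := hK.continuous.measurable
  have hbot : IsBoundedUnder (· ≥ ·) (ae μ) f :=
    isBoundedUnder_of_eventually_ge (Eventually.of_forall fun x => (abs_le.1 (hC x)).1)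
  have htop : IsBoundedUnder (· ≤ ·) (ae μ) f :=
    isBoundedUnder_of_eventually_le (Eventually.of_forall fun x => (abs_le.1 (hC x)).2)
  have hsup : ∀ᵐ x ∂μ, f x ≤ essSup f μ := ae_le_essSup htop
  have hinf : ∀ᵐ x ∂μ, essInf f μ ≤ f x := ae_essInf_le hbot
  have hsup0 : 0 ≤ essSup f μ := by
    by_contra hlt
    have h0 : μ {x | 0 ≤ f x} = 0 := by
      refine measure_mono_null ?_ (ae_iff.1 hsup)
      intro x hx hle
      exact absurd (hle.trans_lt (not_le.1 hlt)) (not_lt.2 hx)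
    rw [h0] at hmed1
    simp at hmed1
  have hinf0 : essInf f μ ≤ 0 := by
    by_contra hlt
    have h0 : μ {x | f x ≤ 0} = 0 := by
      refine measure_mono_null ?_ (ae_iff.1 hinf)
      intro x hx hle
      exact absurd ((not_le.1 hlt).trans_le hle) (not_lt.2 hx)
    rw [h0] at hmed2
    simp at hmed2
  have hhalf : (1 / 2 : ℝ≥0∞).toReal = 1 / 2 := by simp
  have hmed1' : 1 / 2 ≤ μ.real {x | 0 ≤ f x} := by
    rw [← hhalf]
    exact ENNReal.toReal_mono (measure_ne_top _ _) hmed1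
  have hmed2' : 1 / 2 ≤ μ.real {x | f x ≤ 0} := by
    rw [← hhalf]
    exact ENNReal.toReal_mono (measure_ne_top _ _) hmed2
  have hpos := hI.setLIntegral_tail_le hσ (p := distribFn μ f) (L := essSup f μ)
    (fun s hs => ⟨distribFn_nonneg μ f s, by
      have h1 : distribFn μ f s ≤ μ.real {x | f x ≤ 0}ᶜ :=
        measureReal_mono fun x hx => not_le.2 (lt_trans hs hx)
      rw [probReal_compl_eq_one_sub (measurableSet_le hm measurable_const)] at h1
      linarith⟩)
    (fun s hs => by
      rw [distribFn, measureReal_eq_zero_iff]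
      exact measure_mono_null (fun x hx => not_le.2 (lt_trans hs hx)) (ae_iff.1 hsup))
  have hcompl : ∀ s, 1 - distribFn μ f (-s) = μ.real {x | s ≤ -f x} := by
    intro s
    rw [distribFn, ← probReal_compl_eq_one_sub (measurableSet_lt measurable_const hm)]
    congr 1
    ext x
    simp [le_neg]
  have hneg := hI.setLIntegral_tail_le hσ (p := fun s => 1 - distribFn μ f (-s))
    (L := -essInf f μ)
    (fun s hs => ⟨sub_nonneg.2 (distribFn_le_one μ f _), by
      have h1 : μ.real {x | 0 ≤ f x} ≤ distribFn μ f (-s) :=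
        measureReal_mono fun x hx => lt_of_lt_of_le (neg_lt_zero.2 hs) hx
      linarith⟩)
    (fun s hs => by
      rw [hcompl, measureReal_eq_zero_iff]
      refine measure_mono_null (fun x hx => not_le.2 ?_) (ae_iff.1 hinf)
      have : s ≤ -f x := hx
      linarith)
  -- The symmetry of `I` turns the lower tail into the negative levels of `f` itself, so one use of
  -- Ledoux's inequality serves both tails without doubling the gradient term.
  have hflip : ∫⁻ s in Ioi 0, ENNReal.ofReal (I (1 - distribFn μ f (-s))) =
      ∫⁻ s in Iio 0, ENNReal.ofReal (I (distribFn μ f s)) := by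
    have h := (Measure.measurePreserving_neg (volume : Measure ℝ)).setLIntegral_comp_preimage_emb
      (MeasurableEquiv.neg ℝ).measurableEmbedding
      (fun s => ENNReal.ofReal (I (distribFn μ f s))) (Iio 0)
    rw [← h]
    have hset : Neg.neg ⁻¹' Iio (0 : ℝ) = Ioi 0 := by
      ext
      simp
    rw [hset]
    refine lintegral_congr fun s => ?_
    rw [hI.symm _ (distribFn_mem_Icc μ f _)]
  have hLpos : ∫⁻ x, ENNReal.ofReal (f x) ∂μ =
      ∫⁻ s in Ioi 0, ENNReal.ofReal (distribFn μ f s) := by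
    have h := lintegral_eq_lintegral_meas_lt μ (f := fun x => max (f x) 0)
      (Eventually.of_forall fun x => le_max_right _ _) (hm.max measurable_const).aemeasurable
    simp only [ENNReal.ofReal_max, ENNReal.ofReal_zero, max_zero] at h
    rw [h]
    refine setLIntegral_congr_fun measurableSet_Ioi fun s hs => ?_
    simp only [ofReal_distribFn]
    congr 1
    ext x
    simp [not_lt.2 (le_of_lt (mem_Ioi.1 hs))]
  have hLneg : ∫⁻ x, ENNReal.ofReal (-f x) ∂μ =
      ∫⁻ s in Ioi 0, ENNReal.ofReal (1 - distribFn μ f (-s)) := by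
    have h := lintegral_eq_lintegral_meas_le μ (f := fun x => max (-f x) 0)
      (Eventually.of_forall fun x => le_max_right _ _) (hm.neg.max measurable_const).aemeasurable
    simp only [ENNReal.ofReal_max, ENNReal.ofReal_zero, max_zero] at h
    rw [h]
    refine setLIntegral_congr_fun measurableSet_Ioi fun s hs => ?_
    rw [hcompl, ofReal_measureReal]
    congr 1
    ext x
    simp [not_le.2 (mem_Ioi.1 hs)]
  have hsplit : ∫⁻ x, ‖f x‖ₑ ∂μ =
      ∫⁻ x, ENNReal.ofReal (f x) ∂μ + ∫⁻ x, ENNReal.ofReal (-f x) ∂μ := by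
    rw [← lintegral_add_left hm.ennreal_ofReal]
    refine lintegral_congr fun x => ?_
    rw [Real.enorm_eq_ofReal_abs]
    rcases le_total 0 (f x) with h | h
    · rw [abs_of_nonneg h, ENNReal.ofReal_of_nonpos (neg_nonpos.2 h), add_zero]
    · rw [abs_of_nonpos h, ENNReal.ofReal_of_nonpos h, zero_add]
  have hhalves : (∫⁻ s in Ioi 0, ENNReal.ofReal (I (distribFn μ f s))) +
      ∫⁻ s in Iio 0, ENNReal.ofReal (I (distribFn μ f s)) ≤ ∫⁻ x, gradNorm f x ∂μ := by
    have hd : Disjoint (Ioi (0 : ℝ)) (Iio 0) :=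
      Set.disjoint_left.2 fun x hx hx' => lt_asymm (mem_Ioi.1 hx) (mem_Iio.1 hx')
    rw [← lintegral_union measurableSet_Iio hd]
    exact (setLIntegral_le_lintegral _ _).trans (hL f hf)
  rw [hflip] at hneg
  rw [hsplit, hLpos, hLneg]
  refine (add_le_add hpos hneg).trans ?_
  rw [add_add_add_comm, ← mul_add, ← ENNReal.ofReal_add (mul_nonneg hσ.le hsup0)
    (mul_nonneg hσ.le (neg_nonneg.2 hinf0)), ← mul_add, ← sub_eq_add_neg, ← oscOf]
  gcongr

end Bobkov

/-! ### Decreasing rearrangements and the Hardy-Littlewood-Pólya comparison. -/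

section DecRearr

variable {α : Type*} [MeasurableSpace α] (μ : Measure α) (u : α → ℝ≥0∞)

/-- The defining infimum is attained: `{u > l}` is the increasing union of `{u > v n}` for `v n ↓
l`, and measures are continuous from below. -/
theorem lt_decRearr_iff (s : ℝ) (l : ℝ≥0∞) :
    l < decRearr μ u s ↔ ENNReal.ofReal s < μ {x | l < u x} := by
  constructor
  · intro h
    by_contra hlt
    exact absurd (sInf_le (show l ∈ {t : ℝ≥0∞ | μ {x | t < u x} ≤ ENNReal.ofReal s} from
      not_lt.1 hlt)) (not_le.2 h)
  · intro h
    by_contra hlt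
    have hle : decRearr μ u s ≤ l := not_lt.1 hlt
    have hev : ∀ t, l < t → μ {x | t < u x} ≤ ENNReal.ofReal s := by
      intro t ht
      obtain ⟨r, hr, hrt⟩ := sInf_lt_iff.1 (hle.trans_lt ht)
      exact (measure_mono fun x hx => hrt.trans hx).trans hr
    have hltop : l ≠ ∞ := by
      rintro rfl
      simp at h
    obtain ⟨v, hv, hvl, hvt⟩ := exists_seq_strictAnti_tendsto' (lt_top_iff_ne_top.2 hltop)
    have hset : {x | l < u x} = ⋃ n, {x | v n < u x} := by
      ext x
      simp only [mem_ofPred_eq, mem_iUnion]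
      constructor
      · intro hx
        exact ((hvt.eventually (gt_mem_nhds hx))).exists
      · rintro ⟨n, hn⟩
        exact (hvl n).1.trans hn
    have hmono : Monotone fun n => {x | v n < u x} := fun m n hmn x hx =>
      lt_of_le_of_lt (hv.antitone hmn) hx
    rw [hset, hmono.measure_iUnion] at h
    exact absurd (iSup_le fun n => hev (v n) (hvl n).1) (not_le.2 h)

theorem decRearr_antitone : Antitone (decRearr μ u) := by
  intro a b hab
  refine le_of_forall_lt fun l hl => ?_
  rw [lt_decRearr_iff] at hl ⊢
  exact (ENNReal.ofReal_le_ofReal hab).trans_lt hl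

variable {u} [IsProbabilityMeasure μ]

/-- `decRearr μ u`, as a random variable on `(0,1)`, has the same law as `u`. -/
theorem map_decRearr (hu : AEMeasurable u μ) :
    (volume.restrict (Ioo (0 : ℝ) 1)).map (decRearr μ u) = μ.map u := by
  have hm := (decRearr_antitone μ u).measurable
  have hp : IsProbabilityMeasure (volume.restrict (Ioo (0 : ℝ) 1)) := ⟨by simp⟩
  have := Measure.isProbabilityMeasure_map (μ := μ) hu
  have := Measure.isProbabilityMeasure_map (μ := volume.restrict (Ioo (0 : ℝ) 1)) hm.aemeasurable
  refine Measure.ext_of_Iic _ _ fun l => ?_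
  rw [← compl_Ioi, prob_compl_eq_one_sub measurableSet_Ioi, prob_compl_eq_one_sub measurableSet_Ioi]
  congr 1
  rw [Measure.map_apply hm measurableSet_Ioi, Measure.map_apply_of_aemeasurable hu measurableSet_Ioi,
    Measure.restrict_apply (hm measurableSet_Ioi)]
  have h : decRearr μ u ⁻¹' Ioi l ∩ Ioo 0 1 = Ioo 0 (μ.real {x | l < u x}) := by
    ext t
    simp only [mem_inter_iff, mem_preimage, mem_Ioi, mem_Ioo, lt_decRearr_iff]
    rw [← ofReal_measureReal, ENNReal.ofReal_lt_ofReal_iff']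
    have := measureReal_le_one (μ := μ) (s := {x | l < u x})
    constructor
    · rintro ⟨⟨h1, _⟩, h2, _⟩
      exact ⟨h2, h1⟩
    · rintro ⟨h1, h2⟩
      exact ⟨⟨h2, h1.trans h2⟩, h1, h2.trans_le this⟩
  rw [h, Real.volume_Ioo, sub_zero, ofReal_measureReal]
  rfl

theorem lintegral_comp_decRearr (hu : AEMeasurable u μ) {φ : ℝ≥0∞ → ℝ≥0∞} (hφ : Measurable φ) :
    ∫⁻ s in Ioo 0 1, φ (decRearr μ u s) = ∫⁻ x, φ (u x) ∂μ := by
  rw [← lintegral_map hφ (decRearr_antitone μ u).measurable, map_decRearr μ hu,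
    lintegral_map' hφ.aemeasurable hu]

theorem lintegral_decRearr (hu : AEMeasurable u μ) :
    ∫⁻ s in Ioo 0 1, decRearr μ u s = ∫⁻ x, u x ∂μ :=
  lintegral_comp_decRearr μ hu measurable_id

/-- Any threshold `l` gives an upper bound, from `u^* ≤ l + (u^* - l)₊` and equality of laws. The
choice `l = u^*(t)` is optimal, because `u^* ≥ l` before `t` and `u^* ≤ l` after it; this is
`setLIntegral_decRearr_eq`. -/
theorem setLIntegral_decRearr_le (hu : AEMeasurable u μ) {t : ℝ} (ht : t ≤ 1) (l : ℝ≥0∞) :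
    ∫⁻ s in Ioo 0 t, decRearr μ u s ≤ l * ENNReal.ofReal t + ∫⁻ x, (u x - l) ∂μ := by
  calc ∫⁻ s in Ioo 0 t, decRearr μ u s
      ≤ ∫⁻ s in Ioo 0 t, (l + (decRearr μ u s - l)) := lintegral_mono fun s => le_add_tsub
    _ = l * ENNReal.ofReal t + ∫⁻ s in Ioo 0 t, (decRearr μ u s - l) := by
        rw [lintegral_add_left measurable_const]
        simp
    _ ≤ l * ENNReal.ofReal t + ∫⁻ s in Ioo 0 1, (decRearr μ u s - l) := by
        gcongr
    _ = _ := by rw [lintegral_comp_decRearr μ hu (φ := fun x => x - l) (by fun_prop)]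

theorem setLIntegral_decRearr_eq (hu : AEMeasurable u μ) {t : ℝ} (ht : t ≤ 1) :
    ∫⁻ s in Ioo 0 t, decRearr μ u s =
      decRearr μ u t * ENNReal.ofReal t + ∫⁻ x, (u x - decRearr μ u t) ∂μ := by
  refine le_antisymm (setLIntegral_decRearr_le μ hu ht _) ?_
  set l := decRearr μ u t
  have hanti := decRearr_antitone μ u
  calc l * ENNReal.ofReal t + ∫⁻ x, (u x - l) ∂μ
      = l * ENNReal.ofReal t + ∫⁻ s in Ioo 0 1, (decRearr μ u s - l) := by
        rw [lintegral_comp_decRearr μ hu (φ := fun x => x - l) (by fun_prop)]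
    _ = l * ENNReal.ofReal t + ∫⁻ s in Ioo 0 t, (decRearr μ u s - l) := by
        congr 1
        have hz : ∫⁻ s in Ioo 0 1 \ Ioo 0 t, (decRearr μ u s - l) = 0 := by
          rw [setLIntegral_congr_fun (g := fun _ => 0)
            (measurableSet_Ioo.diff measurableSet_Ioo) fun s hs => ?_, lintegral_zero]
          have hts : t ≤ s := by
            by_contra hlt
            exact hs.2 ⟨hs.1.1, not_le.1 hlt⟩
          exact tsub_eq_zero_of_le (hanti hts)
        rw [← lintegral_inter_add_sdiff _ (Ioo (0 : ℝ) 1) (measurableSet_Ioo (a := 0) (b := t)), hz,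
          add_zero, inter_eq_right.2 (Ioo_subset_Ioo_right ht)]
    _ = ∫⁻ s in Ioo 0 t, (l + (decRearr μ u s - l)) := by
        rw [lintegral_add_left measurable_const]
        simp
    _ ≤ ∫⁻ s in Ioo 0 t, decRearr μ u s := by
        refine setLIntegral_mono' measurableSet_Ioo fun s hs => ?_
        exact (add_tsub_cancel_of_le (hanti hs.2.le)).le

end DecRearr

theorem decRearr_congr_ae {α : Type*} [MeasurableSpace α] {ν : Measure α} {u v : α → ℝ≥0∞}
    (h : u =ᵐ[ν] v) : decRearr ν u = decRearr ν v := by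
  funext s
  have h' : ∀ t : ℝ≥0∞, ν {x | t < u x} = ν {x | t < v x} := fun t =>
    measure_congr (h.mono fun x hx => propext (show t < u x ↔ t < v x by rw [hx]))
  simp only [decRearr, h']

/-- If every set `E` is matched by a set `F` of at most the same mass on which `u` has at least the
integral that `g` has on `E`, then the rearrangement of `g` is dominated by that of `u` in the
sense of Hardy, Littlewood and Pólya. -/
theorem setLIntegral_decRearr_mono {α β : Type*} [MeasurableSpace α] [MeasurableSpace β]
    {μ : Measure α} {ν : Measure β} [IsProbabilityMeasure μ] [IsProbabilityMeasure ν]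
    {u : α → ℝ≥0∞} {g : β → ℝ≥0∞} (hu : Measurable u) (hg : Measurable g)
    (hfin : ∀ t, 0 < t → decRearr μ u t ≠ ∞)
    (h : ∀ E : Set β, MeasurableSet E →
      ∃ F : Set α, MeasurableSet F ∧ μ F ≤ ν E ∧ ∫⁻ y in E, g y ∂ν ≤ ∫⁻ x in F, u x ∂μ)
    {t : ℝ} (ht0 : 0 < t) (ht : t ≤ 1) :
    ∫⁻ s in Ioo 0 t, decRearr ν g s ≤ ∫⁻ s in Ioo 0 t, decRearr μ u s := by
  rw [setLIntegral_decRearr_eq μ hu.aemeasurable ht]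
  refine (setLIntegral_decRearr_le ν hg.aemeasurable ht (decRearr μ u t)).trans ?_
  set l := decRearr μ u t
  rw [ENNReal.add_le_add_iff_left (ENNReal.mul_ne_top (hfin t ht0) ENNReal.ofReal_ne_top)]
  have hl : l ≠ ∞ := hfin t ht0
  have hEm : MeasurableSet {y | l < g y} := measurableSet_lt measurable_const hg
  -- With the threshold optimal for `u` used on both sides, only `∫ (g - l)₊ ≤ ∫ (u - l)₊` remains.
  -- The left integral lives on `{g > l}`; adding the finite `l * ν E` restores `g` itself.
  obtain ⟨F, hFm, hF, hint⟩ := h {y | l < g y} hEm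
  set E := {y | l < g y}
  have hEfin : l * ν E ≠ ∞ := ENNReal.mul_ne_top hl (measure_ne_top _ _)
  have h1 : ∫⁻ y, (g y - l) ∂ν = ∫⁻ y in E, (g y - l) ∂ν := by
    refine (setLIntegral_eq_of_support_subset fun y hy => ?_).symm
    exact tsub_pos_iff_lt.1 (pos_iff_ne_zero.2 hy)
  have h2 : l * ν E + ∫⁻ y in E, (g y - l) ∂ν = ∫⁻ y in E, g y ∂ν := by
    rw [← setLIntegral_const, ← lintegral_add_left measurable_const]
    exact setLIntegral_congr_fun hEm fun y hy => add_tsub_cancel_of_le (le_of_lt hy)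
  refine (ENNReal.add_le_add_iff_left hEfin).1 ?_
  calc l * ν E + ∫⁻ y, (g y - l) ∂ν = ∫⁻ y in E, g y ∂ν := by rw [h1, h2]
    _ ≤ ∫⁻ x in F, u x ∂μ := hint
    _ ≤ ∫⁻ x in F, (l + (u x - l)) ∂μ := lintegral_mono fun x => le_add_tsub
    _ = l * μ F + ∫⁻ x in F, (u x - l) ∂μ := by
        rw [lintegral_add_left measurable_const, setLIntegral_const]
    _ ≤ l * ν E + ∫⁻ x, (u x - l) ∂μ := by
        gcongr
        exact Measure.restrict_le_self

/-! ### The level measure: change of variables between levels and masses. -/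

section LevelMeasure

variable {Ω : Type*} [MeasurableSpace Ω] {μ : Measure Ω} [IsProbabilityMeasure μ] {f : Ω → ℝ}

/-- The image of Lebesgue measure under the distribution function has the signed rearrangement as
its primitive. -/
theorem map_distribFn_Ioc (hf : Measurable f) {a b : ℝ} (ha : 0 < a) (hab : a ≤ b) (hb : b < 1) :
    volume.map (distribFn μ f) (Ioc a b) =
      ENNReal.ofReal (signedRearr μ f a - signedRearr μ f b) := by
  -- The levels with `a < μ_f(s) ≤ b` are exactly `[f^★(b), f^★(a))`.
  rw [Measure.map_apply (measurable_distribFn μ f) measurableSet_Ioc, ← Real.volume_Ico]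
  congr 1
  ext s
  rw [mem_preimage, mem_Ioc, mem_Ico, ← lt_signedRearr_iff μ hf ⟨ha, hab.trans_lt hb⟩, and_comm,
    ← not_lt, ← lt_signedRearr_iff μ hf ⟨ha.trans_le hab, hb⟩, not_lt]

theorem deriv_neg_signedRearr_nonneg (hf : Measurable f) {r : ℝ} (hr : r ∈ Ioo (0 : ℝ) 1) :
    0 ≤ deriv (fun q => -signedRearr μ f q) r := by
  rw [← derivWithin_of_isOpen isOpen_Ioo hr]
  have h : MonotoneOn (fun q => -signedRearr μ f q) (Ioo 0 1) := fun x hx y hy hxy =>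
    neg_le_neg (signedRearr_antitoneOn μ hf hx hy hxy)
  exact h.derivWithin_nonneg

theorem withDensity_deriv_signedRearr_Ioc (hf : Measurable f)
    (hac : LocallyAbsContOnUnit (signedRearr μ f)) {a b : ℝ} (ha : 0 < a) (hab : a < b)
    (hb : b < 1) :
    volume.withDensity (fun r => ‖deriv (fun q => -signedRearr μ f q) r‖ₑ) (Ioc a b) =
      ENNReal.ofReal (signedRearr μ f a - signedRearr μ f b) := by
  have hneg : AbsolutelyContinuousOnInterval (fun q => -signedRearr μ f q) a b :=
    (hac a b ha hab hb).neg
  have hint : IntegrableOn (deriv fun q => -signedRearr μ f q) (Ioc a b) :=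
    (intervalIntegrable_iff_integrableOn_Ioc_of_le hab.le).1 hneg.intervalIntegrable_deriv
  have hnn : ∀ r ∈ Ioc a b, 0 ≤ deriv (fun q => -signedRearr μ f q) r := fun r hr =>
    deriv_neg_signedRearr_nonneg hf ⟨ha.trans hr.1, hr.2.trans_lt hb⟩
  have hftc := hneg.integral_deriv_eq_sub
  rw [intervalIntegral.integral_of_le hab.le] at hftc
  rw [withDensity_apply _ measurableSet_Ioc, setLIntegral_congr_fun measurableSet_Ioc fun r hr =>
      Real.enorm_of_nonneg (hnn r hr),
    ← ofReal_integral_eq_lintegral_ofReal hint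
      ((ae_restrict_iff' measurableSet_Ioc).2 (Eventually.of_forall hnn)), hftc]
  congr 1
  ring

/-- Both measures give `f^★(a) - f^★(b)` to `(a, b]`, one by inverting `μ_f`, the other by the
fundamental theorem of calculus. They may be infinite near `0` and `1`, hence the exhaustion by
intervals away from the endpoints. -/
theorem map_distribFn_restrict_eq_withDensity (hf : Measurable f)
    (hac : LocallyAbsContOnUnit (signedRearr μ f)) :
    (volume.map (distribFn μ f)).restrict (Ioo 0 1) =
      (volume.withDensity fun r => ‖deriv (fun q => -signedRearr μ f q) r‖ₑ).restrict
        (Ioo 0 1) := by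
  let e : ℕ → ℝ := fun n => 1 / ((n : ℝ) + 1)
  have he : ∀ n, 0 < e n := fun n => Nat.one_div_pos_of_nat
  have hlim : Tendsto e atTop (𝓝 0) := tendsto_one_div_add_atTop_nhds_zero_nat
  have hU : Ioo (0 : ℝ) 1 = ⋃ n, Ioc (e n) (1 - e n) := by
    ext x
    simp only [mem_Ioo, mem_iUnion, mem_Ioc]
    constructor
    · rintro ⟨h0, h1⟩
      obtain ⟨n, hn1, hn2⟩ := ((hlim.eventually (gt_mem_nhds h0)).and
        (hlim.eventually (gt_mem_nhds (sub_pos.2 h1)))).exists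
      exact ⟨n, hn1, by linarith⟩
    · rintro ⟨n, h0, h1⟩
      exact ⟨(he n).trans h0, by linarith [he n]⟩
  rw [hU, Measure.restrict_iUnion_congr]
  intro n
  have hfin : IsFiniteMeasure ((volume.map (distribFn μ f)).restrict (Ioc (e n) (1 - e n))) := by
    refine ⟨?_⟩
    rw [Measure.restrict_apply_univ]
    rcases le_or_gt (e n) (1 - e n) with h | h
    · rw [map_distribFn_Ioc hf (he n) h (by linarith [he n])]
      exact ENNReal.ofReal_lt_top
    · simp [Ioc_eq_empty_of_le h.le]
  refine Measure.ext_of_Ioc _ _ fun a b _ => ?_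
  rw [Measure.restrict_apply measurableSet_Ioc, Measure.restrict_apply measurableSet_Ioc,
    Ioc_inter_Ioc]
  rcases lt_or_ge (a ⊔ e n) (b ⊓ (1 - e n)) with h | h
  · have h0 : 0 < a ⊔ e n := (he n).trans_le le_sup_right
    have h1 : b ⊓ (1 - e n) < 1 := inf_le_right.trans_lt (by linarith [he n])
    rw [map_distribFn_Ioc hf h0 h.le h1, withDensity_deriv_signedRearr_Ioc hf hac h0 h h1]
  · simp [Ioc_eq_empty_of_le h]

variable {I : ℝ → ℝ}

theorem IsConvexEstimator.continuous_projIcc (hI : IsConvexEstimator I) :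
    Continuous fun r : ℝ => I (projIcc (0 : ℝ) 1 zero_le_one r) :=
  (continuousOn_iff_continuous_domRestrict.1 hI.continuousOn).comp
    _root_.continuous_projIcc

theorem IsConvexEstimator.aemeasurable_deriv_mul (hI : IsConvexEstimator I) (g : ℝ → ℝ) :
    AEMeasurable (fun r => ‖deriv g r * I r‖ₑ) (volume.restrict (Ioo (0 : ℝ) 1)) := by
  have hIm : AEMeasurable I (volume.restrict (Ioo (0 : ℝ) 1)) :=
    (hI.continuousOn.mono Ioo_subset_Icc_self).aemeasurable measurableSet_Ioo
  exact ((measurable_deriv _).aemeasurable.mul hIm).enorm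

/-- Change of variables `s = f^★(r)` in `∫ I(μ_f(s)) ds`. -/
theorem setLIntegral_deriv_signedRearr_mul (hI : IsConvexEstimator I) (hf : Measurable f)
    (hac : LocallyAbsContOnUnit (signedRearr μ f)) {E : Set ℝ} (hE : MeasurableSet E)
    (hE1 : E ⊆ Ioo 0 1) :
    ∫⁻ r in E, ‖deriv (fun q => -signedRearr μ f q) r * I r‖ₑ =
      ∫⁻ s in distribFn μ f ⁻¹' E, ENNReal.ofReal (I (distribFn μ f s)) := by
  -- Nothing is known of `I` off `[0,1]`; clamping the argument gives a globally measurable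
  -- integrand.
  let J : ℝ → ℝ≥0∞ := fun r => ENNReal.ofReal (I (projIcc (0 : ℝ) 1 zero_le_one r))
  have hJm : Measurable J := hI.continuous_projIcc.measurable.ennreal_ofReal
  have hJ : ∀ r ∈ Icc (0 : ℝ) 1, J r = ENNReal.ofReal (I r) := fun r hr => by
    simp only [J, projIcc_of_mem zero_le_one hr]
  have hres : (volume.map (distribFn μ f)).restrict E =
      (volume.withDensity fun r => ‖deriv (fun q => -signedRearr μ f q) r‖ₑ).restrict E :=
    Measure.restrict_congr_mono hE1 (map_distribFn_restrict_eq_withDensity hf hac)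
  calc ∫⁻ r in E, ‖deriv (fun q => -signedRearr μ f q) r * I r‖ₑ
      = ∫⁻ r in E, ((fun r => ‖deriv (fun q => -signedRearr μ f q) r‖ₑ) * J) r := by
        refine setLIntegral_congr_fun hE fun r hr => ?_
        have hr' := Ioo_subset_Icc_self (hE1 hr)
        simp only [Pi.mul_apply, enorm_mul, hJ r hr', Real.enorm_of_nonneg (hI.nonneg r hr')]
    _ = ∫⁻ r in E, J r ∂(volume.map (distribFn μ f)) := by
        rw [hres, setLIntegral_withDensity_eq_setLIntegral_mul _ (measurable_deriv _).enorm hJm hE]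
    _ = ∫⁻ s in distribFn μ f ⁻¹' E, J (distribFn μ f s) :=
        setLIntegral_map hE hJm (measurable_distribFn μ f)
    _ = _ := lintegral_congr fun s => hJ _ (distribFn_mem_Icc μ f s)

/-- On `(0,1)`, away from the atoms of the law of `f`, the signed rearrangement inverts the
distribution function. -/
theorem distribFn_signedRearr (hf : Measurable f) {t : ℝ} (ht : t ∈ Ioo (0 : ℝ) 1)
    (hatom : μ {x | f x = signedRearr μ f t} = 0) :
    distribFn μ f (signedRearr μ f t) = t := by
  have hle : distribFn μ f (signedRearr μ f t) ≤ t :=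
    not_lt.1 ((lt_signedRearr_iff μ hf ht _).not.1 (lt_irrefl _))
  refine hle.antisymm ?_
  by_contra hlt
  have hm : AEMeasurable (signedRearr μ f) (volume.restrict (Ioo (0 : ℝ) 1)) :=
    aemeasurable_restrict_of_antitoneOn measurableSet_Ioo (signedRearr_antitoneOn μ hf)
  -- If `μ_f(f^★(t)) < t`, then `f^★` is constant on this interval of positive length, which would
  -- make its value an atom.
  have hsub : Ioo (distribFn μ f (signedRearr μ f t)) t ⊆
      signedRearr μ f ⁻¹' {signedRearr μ f t} ∩ Ioo 0 1 := by
    intro r hr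
    have hr1 : r ∈ Ioo (0 : ℝ) 1 :=
      ⟨(distribFn_nonneg μ f _).trans_lt hr.1, hr.2.trans ht.2⟩
    refine ⟨le_antisymm ?_ (signedRearr_antitoneOn μ hf hr1 ht hr.2.le), hr1⟩
    exact not_lt.1 ((lt_signedRearr_iff μ hf hr1 _).not.2 (not_lt.2 hr.1.le))
  have hzero : volume (signedRearr μ f ⁻¹' {signedRearr μ f t} ∩ Ioo 0 1) = 0 := by
    rw [← Measure.restrict_apply₀' measurableSet_Ioo.nullMeasurableSet,
      ← Measure.map_apply_of_aemeasurable hm (measurableSet_singleton _), map_signedRearr μ hf,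
      Measure.map_apply hf (measurableSet_singleton _)]
    exact hatom
  have h := measure_mono_null hsub hzero
  rw [Real.volume_Ioo, ENNReal.ofReal_eq_zero] at h
  exact hlt (by linarith)

/-- The law of `μ_f ∘ f` off the atoms of `f` is dominated by Lebesgue measure. -/
theorem measure_preimage_distribFn_diff_atoms_le (hf : Measurable f) {E : Set ℝ}
    (hE : MeasurableSet E) {D : Set ℝ} (hD : MeasurableSet D)
    (hatom : ∀ s ∉ D, μ {x | f x = s} = 0) :
    μ (f ⁻¹' (distribFn μ f ⁻¹' E \ D)) ≤ volume E := by
  have hm : AEMeasurable (signedRearr μ f) (volume.restrict (Ioo (0 : ℝ) 1)) :=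
    aemeasurable_restrict_of_antitoneOn measurableSet_Ioo (signedRearr_antitoneOn μ hf)
  have hS : MeasurableSet (distribFn μ f ⁻¹' E \ D) := (measurable_distribFn μ f hE).diff hD
  rw [← Measure.map_apply hf hS, ← map_signedRearr μ hf, Measure.map_apply_of_aemeasurable hm hS,
    Measure.restrict_apply₀' measurableSet_Ioo.nullMeasurableSet]
  refine measure_mono fun t ht => ?_
  have h := distribFn_signedRearr hf ht.2 (hatom _ ht.1.2)
  have h1 : distribFn μ f (signedRearr μ f t) ∈ E := ht.1.1
  rwa [h] at h1

end LevelMeasure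

/-! ### Localized Ledoux inequality and the symmetrization inequality. -/

section Symmetrization

variable {Ω : Type*} [MetricSpace Ω] [MeasurableSpace Ω] [BorelSpace Ω] {μ : Measure Ω}
  {I : ℝ → ℝ} {f : Ω → ℝ}

/-- Ledoux's inequality for the truncation of `f` between two levels. -/
theorem LedouxIneq.setLIntegral_Ioo_le (hL : LedouxIneq μ I) (hμ : GradVanishesOnLevels μ)
    (hf : IsLip f) {a b : ℝ} (hab : a < b) :
    ∫⁻ s in Ioo a b, ENNReal.ofReal (I (distribFn μ f s)) ≤
      ∫⁻ x in f ⁻¹' Ioo a b, gradNorm f x ∂μ := by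
  obtain ⟨K, hK⟩ := hf
  -- The truncation keeps `μ_f` on `(a, b)`, and its gradient vanishes almost everywhere outside `f
  -- ⁻¹' Ioo a b`, which lies in two level sets of `g`.
  let g : Ω → ℝ := fun x => max (min (f x) b) a
  have hdist : ∀ x y, edist (g x) (g y) ≤ edist (f x) (f y) := fun x y => by
    rw [edist_dist, edist_dist, Real.dist_eq, Real.dist_eq]
    refine ENNReal.ofReal_le_ofReal ((abs_max_sub_max_le_abs _ _ _).trans ?_)
    exact abs_min_sub_min_le_max _ _ _ _ |>.trans (by simp)
  have hg : IsLip g := ⟨K, fun x y => (hdist x y).trans (hK x y)⟩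
  have hS : MeasurableSet (f ⁻¹' Ioo a b) := hK.continuous.measurable measurableSet_Ioo
  have hae : ∀ᵐ x ∂μ, gradNorm g x ≤ (f ⁻¹' Ioo a b).indicator (gradNorm f) x := by
    filter_upwards [hμ g hg a, hμ g hg b] with x ha hb
    by_cases hx : x ∈ f ⁻¹' Ioo a b
    · rw [indicator_of_mem hx]
      exact gradNorm_mono hdist x
    · rw [indicator_of_notMem hx]
      rcases le_or_gt (f x) a with h | h
      · rw [ha (max_eq_right ((min_le_left _ _).trans h))]
      · have h' : b ≤ f x := not_lt.1 fun h' => hx ⟨h, h'⟩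
        rw [hb (by simp only [g]; rw [min_eq_right h', max_eq_left hab.le])]
  calc ∫⁻ s in Ioo a b, ENNReal.ofReal (I (distribFn μ f s))
      = ∫⁻ s in Ioo a b, ENNReal.ofReal (I (distribFn μ g s)) := by
        refine setLIntegral_congr_fun measurableSet_Ioo fun s hs => ?_
        have : distribFn μ f s = distribFn μ g s := by
          unfold distribFn
          congr 1
          ext x
          simp [g, hs.2, not_lt.2 hs.1.le]
        simp only [this]
    _ ≤ ∫⁻ s, ENNReal.ofReal (I (distribFn μ g s)) := setLIntegral_le_lintegral _ _
    _ ≤ ∫⁻ x, gradNorm g x ∂μ := hL g hg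
    _ ≤ ∫⁻ x, (f ⁻¹' Ioo a b).indicator (gradNorm f) x ∂μ := lintegral_mono_ae hae
    _ = _ := lintegral_indicator hS _

variable [IsProbabilityMeasure μ]

/-- The localized Ledoux inequality, on any Borel set of levels. -/
theorem LedouxIneq.setLIntegral_le (hL : LedouxIneq μ I) (hμ : GradVanishesOnLevels μ)
    (hf : IsLip f) {E : Set ℝ} (hE : MeasurableSet E) :
    ∫⁻ s in E, ENNReal.ofReal (I (distribFn μ f s)) ≤ ∫⁻ x in f ⁻¹' E, gradNorm f x ∂μ := by
  have hm : Measurable f := hf.choose_spec.continuous.measurable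
  let ρ : Measure ℝ := volume.withDensity fun s => ENNReal.ofReal (I (distribFn μ f s))
  let ν : Measure ℝ := (μ.withDensity (gradNorm f)).map f
  have hfin : IsFiniteMeasure (μ.withDensity (gradNorm f)) :=
    isFiniteMeasure_withDensity (lintegral_gradNorm_ne_top hf μ)
  have hρν : ρ E ≤ ν E := by
    -- Domination of `ρ` by `ν` on all small closed balls passes to arbitrary sets since `ρ ≪
    -- volume`, which also lets open and closed intervals be exchanged for `ρ`.
    refine (Besicovitch.vitaliFamily (volume : Measure ℝ)).measure_le_of_frequently_le ν
      (withDensity_absolutelyContinuous _ _) E fun x _ => ?_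
    refine Eventually.frequently ?_
    filter_upwards [(Besicovitch.vitaliFamily (volume : Measure ℝ)).eventually_filterAt_mem_setsAt x]
    rintro _ ⟨r, hr, rfl⟩
    have hr' : (0 : ℝ) < r := hr
    simp only [Real.closedBall_eq_Icc]
    calc ρ (Icc (x - r) (x + r)) = ρ (Ioo (x - r) (x + r)) :=
          (measure_congr ((withDensity_absolutelyContinuous _ _).ae_eq Ioo_ae_eq_Icc)).symm
      _ = ∫⁻ s in Ioo (x - r) (x + r), ENNReal.ofReal (I (distribFn μ f s)) :=
          withDensity_apply _ measurableSet_Ioo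
      _ ≤ ∫⁻ x in f ⁻¹' Ioo (x - r) (x + r), gradNorm f x ∂μ :=
          hL.setLIntegral_Ioo_le hμ hf (by linarith)
      _ = ν (Ioo (x - r) (x + r)) := by
          rw [Measure.map_apply hm measurableSet_Ioo,
            withDensity_apply _ (hm measurableSet_Ioo)]
      _ ≤ ν (Icc (x - r) (x + r)) := measure_mono Ioo_subset_Icc_self
  rwa [withDensity_apply _ hE, Measure.map_apply hm hE, withDensity_apply _ (hm hE)] at hρν

/-- The atoms of `f` form a countable set of levels: removing it costs nothing in the level
integral, while over the remaining levels the mass is controlled by `|E|`. -/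
theorem LedouxIneq.exists_measurableSet (hL : LedouxIneq μ I) (hμ : GradVanishesOnLevels μ)
    (hf : IsLip f) {E : Set ℝ} (hE : MeasurableSet E) :
    ∃ S : Set Ω, MeasurableSet S ∧ μ S ≤ volume E ∧
      ∫⁻ s in distribFn μ f ⁻¹' E, ENNReal.ofReal (I (distribFn μ f s)) ≤
        ∫⁻ x in S, gradNorm f x ∂μ := by
  have hm : Measurable f := hf.choose_spec.continuous.measurable
  let D : Set ℝ := {s | 0 < μ {x | f x = s}}
  have hDc : D.Countable := Measure.countable_meas_level_set_pos hm
  have hGE := measurable_distribFn μ f hE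
  refine ⟨f ⁻¹' (distribFn μ f ⁻¹' E \ D), hm (hGE.diff hDc.measurableSet),
    measure_preimage_distribFn_diff_atoms_le hm hE hDc.measurableSet
      fun s hs => nonpos_iff_eq_zero.1 (not_lt.1 hs), ?_⟩
  calc ∫⁻ s in distribFn μ f ⁻¹' E, ENNReal.ofReal (I (distribFn μ f s))
      = ∫⁻ s in distribFn μ f ⁻¹' E \ D, ENNReal.ofReal (I (distribFn μ f s)) := by
        refine setLIntegral_congr ?_
        exact (sdiff_null_ae_eq_self (hDc.measure_zero volume)).symm
    _ ≤ _ := hL.setLIntegral_le hμ hf (hGE.diff hDc.measurableSet)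

/-- A null `E` is matched by a null set in `Ω`, so `I(μ_f)` integrates to `0` over the levels sent
into `E`; as `I > 0` on `(0,1)`, these levels form a null set. -/
theorem LedouxIneq.map_distribFn_absolutelyContinuous (hI : IsConvexEstimator I)
    (hL : LedouxIneq μ I) (hμ : GradVanishesOnLevels μ) (hf : IsLip f) :
    (volume.map (distribFn μ f)).restrict (Ioo 0 1) ≪ volume := by
  refine Measure.AbsolutelyContinuous.mk fun E hE h0 => ?_
  rw [Measure.restrict_apply hE]
  have hE' : MeasurableSet (E ∩ Ioo 0 1) := hE.inter measurableSet_Ioo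
  have hm := measurable_distribFn μ f
  obtain ⟨S, _, hS, hint⟩ := hL.exists_measurableSet hμ hf hE'
  have hS0 : μ S = 0 := nonpos_iff_eq_zero.1 (hS.trans (measure_mono_null inter_subset_left h0).le)
  rw [setLIntegral_measure_zero _ _ hS0, nonpos_iff_eq_zero,
    setLIntegral_eq_zero_iff (hm hE') (hI.measurable_comp hm (distribFn_mem_Icc μ f)).ennreal_ofReal]
    at hint
  rw [Measure.map_apply hm hE']
  refine measure_mono_null ?_ (ae_iff.1 hint)
  intro s hs hcon
  exact absurd (ENNReal.ofReal_eq_zero.1 (hcon hs)) (not_le.2 (hI.pos _ hs.2))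

/-- Up to sign and a constant, `f^★` is the primitive of the Radon-Nikodym density of the level
measure, finite on `(a, b]`. -/
theorem LedouxIneq.locallyAbsContOnUnit (hI : IsConvexEstimator I)
    (hL : LedouxIneq μ I) (hμ : GradVanishesOnLevels μ) (hf : IsLip f) :
    LocallyAbsContOnUnit (signedRearr μ f) := by
  intro a b ha hab hb
  have hm : Measurable f := hf.choose_spec.continuous.measurable
  let N : Measure ℝ := (volume.map (distribFn μ f)).restrict (Ioc a b)
  have hfin : IsFiniteMeasure N := by
    refine ⟨?_⟩
    rw [Measure.restrict_apply_univ, map_distribFn_Ioc hm ha hab.le hb]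
    exact ENNReal.ofReal_lt_top
  have hN : N ≪ volume := by
    refine Measure.AbsolutelyContinuous.trans ?_
      (hL.map_distribFn_absolutelyContinuous hI hμ hf)
    have hsub : Ioc a b ⊆ Ioo 0 1 := fun x hx => ⟨ha.trans hx.1, hx.2.trans_lt hb⟩
    exact (Measure.restrict_mono hsub le_rfl).absolutelyContinuous
  let m : ℝ → ℝ := fun r => (N.rnDeriv volume r).toReal
  have hmi : IntervalIntegrable m volume a b :=
    Measure.integrable_toReal_rnDeriv.intervalIntegrable
  have hprim : ∀ x ∈ uIcc a b, ∫ v in a..x, m v = signedRearr μ f a - signedRearr μ f x := by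
    intro x hx
    rw [uIcc_of_le hab.le] at hx
    rw [intervalIntegral.integral_of_le hx.1, Measure.setIntegral_toReal_rnDeriv hN, measureReal_def,
      Measure.restrict_apply measurableSet_Ioc, inter_eq_left.2 (Ioc_subset_Ioc_right hx.2),
      map_distribFn_Ioc hm ha hx.1 (hx.2.trans_lt hb), ENNReal.toReal_ofReal]
    exact sub_nonneg.2 (signedRearr_antitoneOn μ hm ⟨ha, hab.trans hb⟩
      ⟨ha.trans_le hx.1, hx.2.trans_lt hb⟩ hx.1)
  have hac := hmi.absolutelyContinuousOnInterval_intervalIntegral (c := a) left_mem_uIcc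
  rw [absolutelyContinuousOnInterval_iff] at hac ⊢
  intro ε hε
  obtain ⟨δ, hδ, h⟩ := hac ε hε
  refine ⟨δ, hδ, fun E hE hlen => ?_⟩
  refine lt_of_eq_of_lt (Finset.sum_congr rfl fun i hi => ?_) (h E hE hlen)
  rw [hprim _ (hE.1 i hi).1, hprim _ (hE.1 i hi).2, dist_sub_left]

theorem symmetrizationIneq_of_ledouxIneq (hμ : GradVanishesOnLevels μ) (hI : IsConvexEstimator I)
    (hL : LedouxIneq μ I) : SymmetrizationIneq μ I := by
  intro f hf
  have hac := hL.locallyAbsContOnUnit hI hμ hf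
  refine ⟨hac, fun t ht => ?_⟩
  obtain ⟨K, hK⟩ := id hf
  have hm : Measurable f := hK.continuous.measurable
  have hg := hI.aemeasurable_deriv_mul fun q => -signedRearr μ f q
  have hp : IsProbabilityMeasure (volume.restrict (Ioo (0 : ℝ) 1)) := ⟨by simp⟩
  -- The comparison wants a measurable function, whereas `I` is only almost everywhere measurable
  -- for Lebesgue measure on `(0,1)`.
  rw [decRearr_congr_ae hg.ae_eq_mk]
  refine setLIntegral_decRearr_mono (measurable_gradNorm hK.continuous) hg.measurable_mk
    (fun r _ => ?_) (fun E hE => ?_) ht.1 ht.2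
  · refine ((not_lt.1 fun h => ?_).trans_lt (ENNReal.coe_lt_top (r := K))).ne
    rw [lt_decRearr_iff] at h
    have h0 : {x | (K : ℝ≥0∞) < gradNorm f x} = ∅ :=
      eq_empty_of_forall_notMem fun x hx => absurd hx (not_lt.2 (gradNorm_le hK x))
    simp [h0] at h
  · obtain ⟨S, hSm, hS, hint⟩ := hL.exists_measurableSet hμ hf (hE.inter measurableSet_Ioo)
    refine ⟨S, hSm, hS.trans_eq (Measure.restrict_apply hE).symm, ?_⟩
    refine le_of_eq_of_le ?_ hint
    rw [← setLIntegral_deriv_signedRearr_mul hI hm hac (hE.inter measurableSet_Ioo)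
      inter_subset_right, ← Measure.restrict_restrict hE]
    exact lintegral_congr_ae (ae_restrict_of_ae hg.ae_eq_mk.symm)

theorem ledouxIneq_of_symmetrizationIneq (hI : IsConvexEstimator I) (hS : SymmetrizationIneq μ I) :
    LedouxIneq μ I := by
  intro f hf
  obtain ⟨hac, hle⟩ := hS f hf
  have hcont : Continuous f := hf.choose_spec.continuous
  have hp : IsProbabilityMeasure (volume.restrict (Ioo (0 : ℝ) 1)) := ⟨by simp⟩
  have h := hle 1 ⟨one_pos, le_rfl⟩
  rw [lintegral_decRearr _ (hI.aemeasurable_deriv_mul _),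
    lintegral_decRearr _ (measurable_gradNorm hcont).aemeasurable,
    setLIntegral_deriv_signedRearr_mul hI hcont.measurable hac measurableSet_Ioo subset_rfl] at h
  -- Levels with `μ_f(s)` equal to `0` or `1` contribute nothing, because `I` vanishes at both
  -- endpoints.
  rwa [setLIntegral_eq_of_support_subset] at h
  intro s hs
  have hs' : I (distribFn μ f s) ≠ 0 := fun h0 => hs (by simp [h0])
  refine ⟨(distribFn_nonneg μ f s).lt_of_ne fun h0 => hs' (by rw [← h0, hI.zero]),
    (distribFn_le_one μ f s).lt_of_ne fun h1 => hs' (by rw [h1, hI.one])⟩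

end Symmetrization

theorem theorem3p1 {Ω : Type*} [MetricSpace Ω] [ConnectedSpace Ω] [MeasurableSpace Ω]
    [BorelSpace Ω] (μ : Measure Ω) [IsProbabilityMeasure μ] (hμ : GradVanishesOnLevels μ)
    (I : ℝ → ℝ) (hI : IsConvexEstimator I) :
    List.TFAE [IsoperimetricIneq μ I, LedouxIneq μ I, SymmetrizationIneq μ I, BobkovIneq μ I] := by
  tfae_have 1 → 2 := ledouxIneq_of_isoperimetricIneq
  tfae_have 2 → 3 := symmetrizationIneq_of_ledouxIneq hμ hI
  tfae_have 3 → 2 := ledouxIneq_of_symmetrizationIneq hI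
  tfae_have 2 → 4 := bobkovIneq_of_ledouxIneq hI
  tfae_have 4 → 1 := isoperimetricIneq_of_bobkovIneq hμ hI
  tfae_finish
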